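/- Let $d\in\{2,3\}$ and let $D,S\subset\mathbb{R}^d$ be bounded Lipschitz domains. For $p\in\mathbb{R}^d$ put $S(p)=\{x+p : x\in S\}$, and let $U$ be the set of all $p$ with $S(p)\subset\subset D$ (that is, $\overline{S(p)}$ is compact and contained in $D$). For $p\in U$ let $B(p)\in H^2(D)^*$ be the mean over $S(p)$, $$B(p)v=\frac1{|S|}\int_{S(p)}v\,dx,\qquad v\in H^2(D).$$ Then $U$ is open and the map $U\ni p\mapsto B(p)\in H^2(D)^*$ is Fréchet differentiable. Its derivative at $p\in U$ in the direction $q\in\mathbb{R}^d$ is the functional $$DB(p;q)v=\frac1{|S|}\int_{S(p)}q\cdot\nabla v\,dx=\frac1{|S|}\int_{\partial S(p)}(\nu\cdot q)\,v\,dS,\qquad v\in H^2(D),$$ where $\nu$ is the exterior unit normal of $\partial S(p)$, which exists almost everywhere with respect to the surface measure $dS$ (the normalized $(d-1)$-dimensional Hausdorff measure), and $v$ in the boundary integral is the continuous representative of $v$ in $D$, which exists; the boundary integrand is integrable. Moreover, there is a constant $C$, depending only on $d$, $D$ and $S$, such that $$\big\|B(p+q)-B(p)-DB(p;q)\big\|_{H^2(D)^*}\le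 C\,|q|^{3/2}$$ for all $p\in U$ and all $q\in\mathbb{R}^d$ such that $p+sq\in U$ for every $s\in[0,1]$; in particular, for every $p\in U$ and all sufficiently small $q$. -/

import Mathlib

open MeasureTheory Set Topology
open scoped RealInnerProductSpace ContDiff ENNReal

noncomputable section

namespace SensorDerivative

/-- The Euclidean space `ℝ^d`. -/
abbrev Euc (d : ℕ) : Type := EuclideanSpace ℝ (Fin d)

variable {d : ℕ}

/-- A bounded Lipschitz domain in `ℝ^d`: a bounded, connected, open set that, in a ball around each
of its boundary points, is the strict epigraph of a Lipschitz function in a rotated Cartesian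
coordinate system. The unit vector `e` is the direction of the graph, and the function `γ` of the
remaining variables is evaluated at the orthogonal projection of `x` to `eᗮ`. -/
structure IsBoundedLipschitzDomain (S : Set (Euc d)) : Prop where
  isOpen : IsOpen S
  isConnected : IsConnected S
  isBounded : Bornology.IsBounded S
  lipschitz_boundary : ∀ x₀ ∈ frontier S, ∃ e : Euc d, ‖e‖ = 1 ∧ ∃ r > (0 : ℝ),
    ∃ (K : NNReal) (γ : Euc d → ℝ), LipschitzWith K γ ∧
      ∀ x ∈ Metric.ball x₀ r, (x ∈ S ↔ γ (x - ⟪e, x⟫ • e) < ⟪e, x⟫)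

/-- `A ⊂⊂ D`: the closure of `A` is compact and contained in `D`. -/
def CompactlyContained (A D : Set (Euc d)) : Prop :=
  IsCompact (closure A) ∧ closure A ⊆ D

/-- The real Hilbert space `L²(D)`. -/
abbrev L2 (D : Set (Euc d)) : Type := Lp ℝ 2 (volume.restrict D)

/-- `g` is the weak partial derivative of `f` in `D` with respect to the `i`-th coordinate. -/
def HasWeakPartial (D : Set (Euc d)) (i : Fin d) (f g : L2 D) : Prop :=
  ∀ φ : Euc d → ℝ, ContDiff ℝ ∞ φ → HasCompactSupport φ → tsupport φ ⊆ D →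
    ∫ x in D, f x * fderiv ℝ φ x (EuclideanSpace.single i 1) = - ∫ x in D, g x * φ x

/-- Labels of `v`, of `∂ᵢ v` and of `∂ⱼ ∂ᵢ v`. -/
abbrev Jet (d : ℕ) : Type := Unit ⊕ Fin d ⊕ (Fin d × Fin d)

/-- The Sobolev space `H²(D)`. An element is a function `v ∈ L²(D)` together with its first and
second weak partial derivatives in `L²(D)` (which, for open `D`, are uniquely determined by `v`).
The norm is inherited from the finite `ℓ²`-product of copies of `L²(D)`, that is,
`‖v‖² = ‖v‖²_{L²} + ∑ᵢ ‖∂ᵢ v‖²_{L²} + ∑ᵢⱼ ‖∂ⱼ ∂ᵢ v‖²_{L²}`. -/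
def H2 (D : Set (Euc d)) : Submodule ℝ (PiLp 2 fun _ : Jet d => L2 D) where
  carrier := {V | (∀ i, HasWeakPartial D i (V (.inl ())) (V (.inr (.inl i)))) ∧
    ∀ i j, HasWeakPartial D j (V (.inr (.inl i))) (V (.inr (.inr (i, j))))}
  add_mem' := by
    have key : ∀ (i : Fin d) (f g f' g' : L2 D), HasWeakPartial D i f g →
        HasWeakPartial D i f' g' → HasWeakPartial D i (f + f') (g + g') := by
      intro i f g f' g' h h' φ hφ hc hs
      have hb := (hφ.continuous_fderiv (by simp)).clm_apply
        (continuous_const (y := EuclideanSpace.single i (1 : ℝ)))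
      have hbc : HasCompactSupport fun x => fderiv ℝ φ x (EuclideanSpace.single i 1) :=
        hc.fderiv_apply (𝕜 := ℝ) _
      have int : ∀ (u : L2 D) (ψ : Euc d → ℝ), Continuous ψ → HasCompactSupport ψ →
          Integrable (fun x => u x * ψ x) (volume.restrict D) := fun u ψ h1 h2 =>
        MemLp.integrable_mul (p := 2) (q := 2) (Lp.memLp u) (h1.memLp_of_hasCompactSupport h2)
      have e1 : ∫ x in D, (f + f') x * fderiv ℝ φ x (EuclideanSpace.single i 1) =
          ∫ x in D, (f x * fderiv ℝ φ x (EuclideanSpace.single i 1) +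
            f' x * fderiv ℝ φ x (EuclideanSpace.single i 1)) := by
        refine integral_congr_ae ?_
        filter_upwards [Lp.coeFn_add f f'] with x hx
        rw [hx, Pi.add_apply, add_mul]
      have e2 : ∫ x in D, (g + g') x * φ x = ∫ x in D, (g x * φ x + g' x * φ x) := by
        refine integral_congr_ae ?_
        filter_upwards [Lp.coeFn_add g g'] with x hx
        rw [hx, Pi.add_apply, add_mul]
      rw [e1, e2, integral_add (int _ _ hb hbc) (int _ _ hb hbc),
        integral_add (int _ _ hφ.continuous hc) (int _ _ hφ.continuous hc), h φ hφ hc hs,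
        h' φ hφ hc hs]
      ring
    rintro V W ⟨h1, h2⟩ ⟨h1', h2'⟩
    exact ⟨fun i => key i _ _ _ _ (h1 i) (h1' i), fun i j => key j _ _ _ _ (h2 i j) (h2' i j)⟩
  zero_mem' := by
    have key : ∀ i : Fin d, HasWeakPartial D i 0 0 := by
      intro i φ _ _ _
      have h0 : ∀ ψ : Euc d → ℝ, ∫ x in D, (0 : L2 D) x * ψ x = 0 := by
        intro ψ
        refine integral_eq_zero_of_ae ?_
        filter_upwards [Lp.coeFn_zero ℝ 2 (volume.restrict D)] with x hx
        rw [hx]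
        exact zero_mul _
      rw [h0, h0, neg_zero]
    exact ⟨fun i => key i, fun i j => key j⟩
  smul_mem' := by
    have key : ∀ (i : Fin d) (c : ℝ) (f g : L2 D), HasWeakPartial D i f g →
        HasWeakPartial D i (c • f) (c • g) := by
      intro i c f g h φ hφ hc hs
      have hm : ∀ (u : L2 D) (ψ : Euc d → ℝ),
          ∫ x in D, (c • u) x * ψ x = c * ∫ x in D, u x * ψ x := by
        intro u ψ
        rw [← integral_const_mul]
        refine integral_congr_ae ?_
        filter_upwards [Lp.coeFn_smul c u] with x hx
        rw [hx, Pi.smul_apply, smul_eq_mul, mul_assoc]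
      rw [hm, hm, h φ hφ hc hs, mul_neg]
    rintro c V ⟨h1, h2⟩
    exact ⟨fun i => key i c _ _ (h1 i), fun i j => key j c _ _ (h2 i j)⟩

/-- The inclusion `H²(D) → L²(D)`. -/
def H2.val (D : Set (Euc d)) : H2 D →L[ℝ] L2 D :=
  (PiLp.proj 2 (fun _ : Jet d => L2 D) (.inl ())).comp (H2 D).subtypeL

/-- The weak partial derivative `∂ᵢ : H²(D) → L²(D)`. -/
def H2.pd (D : Set (Euc d)) (i : Fin d) : H2 D →L[ℝ] L2 D :=
  (PiLp.proj 2 (fun _ : Jet d => L2 D) (.inr (.inl i))).comp (H2 D).subtypeL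

/-- The weak gradient of `v ∈ H²(D)`, as a vector field. -/
def H2.grad {D : Set (Euc d)} (v : H2 D) (x : Euc d) : Euc d :=
  WithLp.toLp 2 fun i => H2.pd D i v x

/-- The sensor `S(p) = {x + p | x ∈ S}`. -/
def sensor (S : Set (Euc d)) (p : Euc d) : Set (Euc d) := (fun x => x + p) '' S

/-- The set `U` of the positions `p` with `S(p) ⊂⊂ D`. -/
def admissible (S D : Set (Euc d)) : Set (Euc d) := {p | CompactlyContained (sensor S p) D}

theorem IsBoundedLipschitzDomain.sensor_meas {S : Set (Euc d)} (hS : IsBoundedLipschitzDomain S)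
    (p : Euc d) : MeasurableSet (sensor S p) ∧ volume (sensor S p) ≠ ⊤ := by
  refine ⟨((Homeomorph.addRight p).isOpenMap _ hS.isOpen).measurableSet, ?_⟩
  have : volume (sensor S p) = volume S := by
    simp [sensor]
  rw [this]
  exact hS.isBounded.measure_lt_top.ne

/-- The functional `f ↦ ∫_{A ∩ D} f dx` on `L²(D)`, for a measurable set `A` of finite volume. -/
def integralOn (D A : Set (Euc d)) (hA : MeasurableSet A ∧ volume A ≠ ⊤) : L2 D →L[ℝ] ℝ :=
  have hfin : volume.restrict D A ≠ ⊤ :=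
    ((Measure.restrict_apply_le D A).trans_lt hA.2.lt_top).ne
  have heq : ∀ f : L2 D, ∫ x in A, f x ∂(volume.restrict D) =
      ⟪(indicatorConstLp 2 hA.1 hfin (1 : ℝ) : L2 D), f⟫ := fun f =>
    (L2.inner_indicatorConstLp_one (𝕜 := ℝ) hA.1 hfin f).symm
  LinearMap.mkContinuous
    { toFun := fun f => ∫ x in A, f x ∂(volume.restrict D)
      map_add' := fun f g => by rw [heq, heq, heq, inner_add_right]
      map_smul' := fun c f => by rw [heq, heq, inner_smul_right]; rfl }
    ‖(indicatorConstLp 2 hA.1 hfin (1 : ℝ) : L2 D)‖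
    fun f => by
      change ‖∫ x in A, f x ∂(volume.restrict D)‖ ≤ _
      rw [heq]
      exact norm_inner_le_norm _ _

/-- The measurement `B(p) ∈ H²(D)*`, `B(p) v = |S|⁻¹ ∫_{S(p)} v dx` for `S(p) ⊆ D`. (For the other
`p`, the function `v` is extended by zero outside `D`.) -/
def sensorMean (D : Set (Euc d)) {S : Set (Euc d)} (hS : IsBoundedLipschitzDomain S) (p : Euc d) :
    H2 D →L[ℝ] ℝ :=
  (volume.real S)⁻¹ • (integralOn D (sensor S p) (hS.sensor_meas p)).comp (H2.val D)

/-- The map `q ↦ DB(p; q) ∈ H²(D)*`, `DB(p; q) v = |S|⁻¹ ∫_{S(p)} q · ∇v dx` for `S(p) ⊆ D`, as a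
continuous linear map of the direction `q`. -/
def sensorMeanDeriv (D : Set (Euc d)) {S : Set (Euc d)} (hS : IsBoundedLipschitzDomain S)
    (p : Euc d) : Euc d →L[ℝ] (H2 D →L[ℝ] ℝ) :=
  ∑ i : Fin d, (EuclideanSpace.proj (𝕜 := ℝ) i : Euc d →L[ℝ] ℝ).smulRight
    ((volume.real S)⁻¹ • (integralOn D (sensor S p) (hS.sensor_meas p)).comp (H2.pd D i))

/-- `n` is the exterior unit normal of `A` at `x`: a unit vector such that, for every opening
`ε > 0`, close to `x` the set `A` contains the open cone of aperture `ε` about `-n` with vertex `x`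
and is disjoint from the one about `n`. Where `A` is locally an epigraph, this means
differentiability of the graph at `x`. -/
def IsExteriorUnitNormal (A : Set (Euc d)) (x n : Euc d) : Prop :=
  ‖n‖ = 1 ∧ ∀ ε > (0 : ℝ), ∃ r > (0 : ℝ), ∀ y ∈ Metric.ball x r,
    (⟪n, y - x⟫ < -ε * ‖y - x‖ → y ∈ A) ∧ (ε * ‖y - x‖ < ⟪n, y - x⟫ → y ∉ A)

theorem IsExteriorUnitNormal.unique {A : Set (Euc d)} {x n m : Euc d}
    (hn : IsExteriorUnitNormal A x n) (hm : IsExteriorUnitNormal A x m) : n = m := by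
  by_contra hne
  have hw : 0 < ‖m - n‖ := norm_pos_iff.2 (sub_ne_zero.2 (Ne.symm hne))
  have hsq : ‖m - n‖ ^ 2 = 2 * (1 - ⟪n, m⟫) := by
    rw [norm_sub_sq_real, hm.1, hn.1, real_inner_comm]; ring
  have hnn : ⟪n, n⟫ = 1 := by rw [real_inner_self_eq_norm_sq, hn.1]; norm_num
  have hmm : ⟪m, m⟫ = 1 := by rw [real_inner_self_eq_norm_sq, hm.1]; norm_num
  have hε : 0 < ‖m - n‖ / 4 := by positivity
  obtain ⟨r, hr, h1⟩ := hn.2 _ hε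
  obtain ⟨r', hr', h2⟩ := hm.2 _ hε
  have ht : 0 < min r r' / (2 * ‖m - n‖) := by positivity
  set t := min r r' / (2 * ‖m - n‖) with ht'
  have htw : t * ‖m - n‖ = min r r' / 2 := by rw [ht']; field_simp
  have hmin : 0 < min r r' := lt_min hr hr'
  have hd : ‖x + t • (m - n) - x‖ = t * ‖m - n‖ := by
    rw [add_sub_cancel_left, norm_smul, Real.norm_of_nonneg ht.le]
  have hb : ∀ ρ, min r r' ≤ ρ → x + t • (m - n) ∈ Metric.ball x ρ := by
    intro ρ hρ
    rw [mem_ball_iff_norm, hd, htw]; linarith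
  refine (h2 _ (hb _ (min_le_right _ _))).2 ?_ ((h1 _ (hb _ (min_le_left _ _))).1 ?_)
  · rw [hd, add_sub_cancel_left, inner_smul_right, inner_sub_right, hmm, real_inner_comm]
    nlinarith [mul_pos ht (pow_pos hw 2)]
  · rw [hd, add_sub_cancel_left, inner_smul_right, inner_sub_right, hnn]
    nlinarith [mul_pos ht (pow_pos hw 2)]

open Classical in
/-- The exterior unit normal field `ν` of `∂A` (with value `0` where there is no normal). -/
def exteriorNormal (A : Set (Euc d)) (x : Euc d) : Euc d :=
  if h : ∃ n, IsExteriorUnitNormal A x n then h.choose else 0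

/-- The surface measure on `∂A`: the `(d - 1)`-dimensional Hausdorff measure, in the normalization
that agrees with the Lebesgue measure on `ℝ^(d-1)`. -/
def surfaceMeasure (A : Set (Euc d)) : Measure (Euc d) :=
  (Measure.euclideanHausdorffMeasure (d - 1)).restrict (frontier A)

end SensorDerivative

end

open SensorDerivative

/-!
Three arguments are combined: a Taylor estimate for the sensor means, the Sobolev embedding of
`H²(D)` into `C(D)`, and the formula for the derivative of `t ↦ ∫_{A + t q} w` as a boundary
integral.

**Differentiability.** Replace the indicator function of `S` by a test function `φ` with support in
`S` that is close to it in `L²` (`exists_testFunction_approx`). Then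
`t ↦ ∫_D v(x) φ(x - p - t q) dx` can be differentiated twice by differentiating `φ`, and the
definition of the weak derivatives turns the derivatives of `φ` into those of `v`. So the second
derivative in `t` is at most `C |q|² ‖v‖`, uniformly in `φ`, as long as the sensor stays in `D`
(`abs_testFunction_taylor_le`), and letting `φ` tend to the indicator function gives a quadratic
remainder. No regularity of `∂S` is needed here. As `D` is bounded, `|q|` is at most the diameter
of `D`, so the remainder is also `O(|q|^(3/2))` (`exists_norm_sensorMean_taylor_le_rpow`).

**Continuous representative.** For a radial bump function `β` let `m(x, r)` be the weighted average
of `v` over the ball of radius `r` about `x` with the density `β'(|y - x|² / r²)`. The derivative of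
`m` in `r` is `-r^(-d-1)` times the integral of `v` against `r²` times a Laplacian of a function
supported in this ball; moving the Laplacian to `v` and applying the Cauchy–Schwarz inequality
bounds it by a multiple of `r^(1 - d/2) ‖v‖` (`exists_abs_deriv_radialMean_le`). This is integrable
at `0` for `d ≤ 3`, so the continuous functions `m(·, r)` converge locally uniformly in `D` as
`r → 0`; by Lebesgue's differentiation theorem the limit is a multiple of `v` almost everywhere
(`exists_continuousOn_representative`).

**Boundary integral.** Both the existence of the normal and the boundary formula are local. Where
the domain is the epigraph of a Lipschitz function `γ`, Rademacher's theorem gives `∇γ` almost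
everywhere, and `(∇γ, -1) / √(1 + |∇γ|²)` is then the exterior normal
(`IsEpigraphOn.isExteriorUnitNormal`). By Fubini's theorem and differentiation under the integral
sign, the derivative of the integral of a continuous function over the moving epigraph is an
integral over the base (`hasDerivAt_integral_movedEpigraph`). The area formula identifies it with a
surface integral: the Hausdorff measure on the graph is the image of `√(1 + |∇γ|²) dy`
(`restrict_range_graphMap`), which is proved by cutting the base into countably many pieces on which
`γ` is nearly linear and comparing the graph with its linear model through a map with Lipschitz
constants close to `1`. A partition of unity gives the formula for the whole boundary
(`IsBoundedLipschitzDomain.hasBoundaryDeriv`).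

Applied to the continuous representative of `v`, this is a second expression for the derivative of
`p ↦ ∫_{S(p)} v`. Derivatives are unique, so the two expressions agree
(`sensorMeanDeriv_eq_boundary_integral`): the divergence theorem on `S(p)` comes out as a
by-product.
-/

open SensorDerivative

noncomputable section

namespace SensorDerivative

open Filter

section Taylor

variable {d : ℕ}

/-! ### Test functions and the Cauchy–Schwarz inequality in `L²(D)` -/

theorem exists_contDiff_cutoff {S K : Set (Euc d)} (hS : IsOpen S) (hb : Bornology.IsBounded S)
    (hK : IsClosed K) (hKS : K ⊆ S) :
    ∃ φ : Euc d → ℝ, ContDiff ℝ ∞ φ ∧ HasCompactSupport φ ∧ tsupport φ ⊆ S ∧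
      (∀ x, φ x ∈ Icc (0 : ℝ) 1) ∧ ∀ x ∈ K, φ x = 1 := by
  obtain ⟨f, h0, h1, hf⟩ := exists_contMDiffMap_zero_one_nhds_of_isClosed (n := (⊤ : ℕ∞))
    (modelWithCornersSelf ℝ (Euc d)) hS.isClosed_compl hK
    (disjoint_compl_left_iff_subset.2 hKS)
  have hsub : tsupport f ⊆ S := by
    intro x hx
    by_contra hxS
    exact notMem_tsupport_iff_eventuallyEq.2 (eventually_nhdsSet_iff_forall.1 h0 x hxS) hx
  refine ⟨f, f.contMDiff.contDiff, ?_, hsub, hf, fun x hx => h1.self_of_nhdsSet x hx⟩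
  exact Metric.isCompact_of_isClosed_isBounded (isClosed_tsupport _) (hb.subset hsub)

theorem integrable_mul_of_bounded {D : Set (Euc d)} (hD : Bornology.IsBounded D) (f : L2 D)
    {ψ : Euc d → ℝ} (hψ : Measurable ψ) {c : ℝ} (hc : ∀ x, |ψ x| ≤ c) :
    Integrable (fun x => f x * ψ x) (volume.restrict D) := by
  have : IsFiniteMeasure (volume.restrict D) := ⟨by simpa using hD.measure_lt_top⟩
  refine MemLp.integrable_mul (p := 2) (q := 2) (Lp.memLp f) ?_
  exact MemLp.of_bound hψ.aestronglyMeasurable c (Eventually.of_forall hc)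

/-- Cauchy–Schwarz for a function in `L²(D)` and a function bounded by `c` that vanishes
outside `A`. -/
theorem abs_setIntegral_mul_le {D A : Set (Euc d)} (f : L2 D) {ψ : Euc d → ℝ}
    (hψ : Measurable ψ) (hA : MeasurableSet A) (hfin : volume A ≠ ⊤) {c : ℝ} (hc : 0 ≤ c)
    (h1 : ∀ x ∈ A, |ψ x| ≤ c) (h0 : ∀ x ∉ A, ψ x = 0) :
    |∫ x in D, f x * ψ x| ≤ c * √(volume.real A) * ‖f‖ := by
  have hfin' : volume.restrict D A ≠ ⊤ :=
    ((Measure.restrict_apply_le D A).trans_lt hfin.lt_top).ne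
  have hle : ∀ x, ‖ψ x‖ ≤ ‖A.indicator (fun _ => c) x‖ := by
    intro x
    by_cases hx : x ∈ A
    · rw [indicator_of_mem hx, Real.norm_of_nonneg hc]; exact h1 x hx
    · rw [h0 x hx, norm_zero]; exact norm_nonneg _
  have hmem : MemLp ψ 2 (volume.restrict D) :=
    (memLp_indicator_const 2 hA c (Or.inr hfin')).mono hψ.aestronglyMeasurable
      (Eventually.of_forall hle)
  have e1 : ∫ x in D, f x * ψ x = ⟪hmem.toLp ψ, f⟫ := by
    rw [L2.inner_def]
    refine integral_congr_ae ?_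
    filter_upwards [hmem.coeFn_toLp] with x hx
    simp [hx]
  have e2 : ‖hmem.toLp ψ‖ ≤ c * √(volume.real A) := by
    rw [Lp.norm_toLp]
    have h2 : eLpNorm ψ 2 (volume.restrict D) ≤ ENNReal.ofReal (c * √(volume.real A)) := by
      refine (eLpNorm_mono hle).trans ?_
      rw [eLpNorm_indicator_const hA (by norm_num) (by norm_num),
        ENNReal.ofReal_mul hc, Real.enorm_of_nonneg hc]
      gcongr
      rw [Real.sqrt_eq_rpow, ← ENNReal.ofReal_rpow_of_nonneg measureReal_nonneg (by norm_num),
        ofReal_measureReal hfin]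
      norm_num
      gcongr
      exact Measure.restrict_le_self
    refine ENNReal.toReal_le_of_le_ofReal (by positivity) h2
  rw [e1]
  exact (abs_real_inner_le_norm _ _).trans (by gcongr)

/-- Smooth functions with compact support in `S` approximate the indicator function of `S` in
`L²`, uniformly with respect to translations. -/
theorem exists_testFunction_approx {S : Set (Euc d)} (hS : IsOpen S)
    (hb : Bornology.IsBounded S) (D : Set (Euc d)) (hD : Bornology.IsBounded D) {ε : ℝ}
    (hε : 0 < ε) :
    ∃ φ : Euc d → ℝ, ContDiff ℝ ∞ φ ∧ HasCompactSupport φ ∧ tsupport φ ⊆ S ∧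
      (∀ x, φ x ∈ Icc (0 : ℝ) 1) ∧ ∀ (f : L2 D) (p : Euc d),
        |(∫ x in D, f x * φ (x - p)) - ∫ x in sensor S p, f x ∂(volume.restrict D)| ≤
          ε * ‖f‖ := by
  have hε2 : ENNReal.ofReal (ε ^ 2) ≠ 0 := by
    rw [Ne, ENNReal.ofReal_eq_zero, not_le]; positivity
  obtain ⟨K, hKS, hK, hKε⟩ := hS.measurableSet.exists_isCompact_lt_add (μ := volume)
    hb.measure_lt_top.ne hε2
  obtain ⟨φ, hφ, hφc, hφS, hφ01, hφK⟩ := exists_contDiff_cutoff hS hb hK.isClosed hKS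
  refine ⟨φ, hφ, hφc, hφS, hφ01, fun f p => ?_⟩
  have hmeas : MeasurableSet (sensor S p) :=
    ((Homeomorph.addRight p).isOpenMap _ hS).measurableSet
  have hmemS : ∀ x, x ∈ sensor S p ↔ x - p ∈ S := fun x =>
    ⟨by rintro ⟨y, hy, rfl⟩; simpa using hy, fun h => ⟨x - p, h, by simp⟩⟩
  have hmφ : Measurable fun x => φ (x - p) :=
    (hφ.continuous.comp (continuous_id.sub continuous_const)).measurable
  have hm1 : Measurable ((sensor S p).indicator fun _ => (1 : ℝ)) :=
    measurable_const.indicator hmeas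
  have e1 : ∫ x in sensor S p, f x ∂(volume.restrict D) =
      ∫ x in D, f x * (sensor S p).indicator (fun _ => (1 : ℝ)) x := by
    rw [← integral_indicator hmeas]
    refine integral_congr_ae (Eventually.of_forall fun x => ?_)
    by_cases hx : x ∈ sensor S p <;> simp [hx]
  rw [e1, ← integral_sub]
  rotate_left
  · refine integrable_mul_of_bounded hD f hmφ (c := 1) fun x => ?_
    rw [abs_of_nonneg (hφ01 _).1]; exact (hφ01 _).2
  · refine integrable_mul_of_bounded hD f hm1 (c := 1) fun x => ?_
    by_cases hx : x ∈ sensor S p <;> simp [hx]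
  simp_rw [← mul_sub]
  have hA : MeasurableSet ((fun x => x - p) ⁻¹' (S \ K)) :=
    (measurable_id.sub_const p) (hS.measurableSet.diff hK.measurableSet)
  have hvol : volume ((fun x => x - p) ⁻¹' (S \ K)) = volume (S \ K) :=
    (measurePreserving_sub_right volume p).measure_preimage
      (hS.measurableSet.diff hK.measurableSet).nullMeasurableSet
  have hlt : volume (S \ K) < ENNReal.ofReal (ε ^ 2) := by
    rw [measure_sdiff hKS hK.measurableSet.nullMeasurableSet hK.measure_lt_top.ne]
    exact ENNReal.sub_lt_of_lt_add (measure_mono hKS) (by rwa [add_comm])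
  refine (abs_setIntegral_mul_le f (hmφ.sub hm1) hA
    (by rw [hvol]; exact hlt.ne_top) zero_le_one ?_ ?_).trans ?_
  · intro x hx
    have hxS : x ∈ sensor S p := (hmemS x).2 hx.1
    simp only [Pi.sub_apply, hxS, indicator_of_mem]
    rw [abs_le]
    constructor <;> linarith [(hφ01 (x - p)).1, (hφ01 (x - p)).2]
  · intro x hx
    by_cases hxS : x ∈ sensor S p
    · have : x - p ∈ K := by
        by_contra h; exact hx ⟨(hmemS x).1 hxS, h⟩
      simp [hxS, hφK _ this]
    · have : φ (x - p) = 0 :=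
        image_eq_zero_of_notMem_tsupport fun h => hxS ((hmemS x).2 (hφS h))
      simp [hxS, this]
  · rw [one_mul]
    gcongr
    rw [Real.sqrt_le_left hε.le, measureReal_def, hvol]
    exact ENNReal.toReal_le_of_le_ofReal (by positivity) hlt.le

/-! ### Translating a test function along a line -/

theorem hasDerivAt_integral_translate {D : Set (Euc d)} (hD : Bornology.IsBounded D) (f : L2 D)
    {φ : Euc d → ℝ} (hφ : ContDiff ℝ ∞ φ) (hc : HasCompactSupport φ) (p q : Euc d) (t : ℝ) :
    HasDerivAt (fun t : ℝ => ∫ x in D, f x * φ (x - (p + t • q)))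
      (- ∫ x in D, f x * fderiv ℝ φ (x - (p + t • q)) q) t := by
  have hcont : Continuous (fderiv ℝ φ) := hφ.continuous_fderiv (by simp)
  obtain ⟨C, hC⟩ := hcont.norm.bddAbove_range_of_hasCompactSupport (hc.fderiv (𝕜 := ℝ)).norm
  obtain ⟨C', hC'⟩ := hφ.continuous.norm.bddAbove_range_of_hasCompactSupport hc.norm
  have hC : ∀ x, ‖fderiv ℝ φ x‖ ≤ C := fun x => hC ⟨x, rfl⟩
  have hC' : ∀ x, |φ x| ≤ C' := fun x => hC' ⟨x, rfl⟩
  have hsub : ∀ s : ℝ, Continuous fun x : Euc d => x - (p + s • q) := fun s => by fun_prop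
  have : IsFiniteMeasure (volume.restrict D) := ⟨by simpa using hD.measure_lt_top⟩
  have hfi : Integrable f (volume.restrict D) := (Lp.memLp f).integrable (by norm_num)
  rw [← integral_neg]
  refine (hasDerivAt_integral_of_dominated_loc_of_deriv_le (s := univ)
    (bound := fun x => ‖f x‖ * (C * ‖q‖))
    (F' := fun t x => - (f x * fderiv ℝ φ (x - (p + t • q)) q)) univ_mem ?_ ?_ ?_ ?_ ?_ ?_).2
  · refine Eventually.of_forall fun s => ?_
    exact (integrable_mul_of_bounded hD f (hφ.continuous.comp (hsub s)).measurable
      fun x => hC' _).aestronglyMeasurable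
  · exact integrable_mul_of_bounded hD f (hφ.continuous.comp (hsub t)).measurable fun x => hC' _
  · refine ((Lp.aestronglyMeasurable f).mul ?_).neg
    exact ((hcont.comp (hsub t)).clm_apply continuous_const).aestronglyMeasurable
  · refine Eventually.of_forall fun x s _ => ?_
    rw [norm_neg, norm_mul]
    gcongr
    exact ((fderiv ℝ φ _).le_opNorm q).trans (by gcongr; exact hC _)
  · exact hfi.norm.mul_const _
  · refine Eventually.of_forall fun x s _ => ?_
    have h1 : HasDerivAt (fun s : ℝ => x - (p + s • q)) (-q) s := by
      simpa using (((hasDerivAt_id s).smul_const q).const_add p).const_sub x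
    have h2 := ((hφ.differentiable (by simp)) (x - (p + s • q))).hasFDerivAt.comp_hasDerivAt s h1
    simpa using h2.const_mul (f x)

/-- The defining identity of weak derivatives, for a translated test function. -/
theorem setIntegral_mul_fderiv_translate_single {D : Set (Euc d)} {f g : L2 D} {i : Fin d}
    (hg : HasWeakPartial D i f g) {φ : Euc d → ℝ} (hφ : ContDiff ℝ ∞ φ)
    (hc : HasCompactSupport φ) {a : Euc d} (ha : ∀ x ∈ tsupport φ, x + a ∈ D) :
    ∫ x in D, f x * fderiv ℝ φ (x - a) (EuclideanSpace.single i 1) =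
      - ∫ x in D, g x * φ (x - a) := by
  have hcomp : ContDiff ℝ ∞ fun x => φ (x - a) := hφ.comp (contDiff_id.sub contDiff_const)
  have hts : tsupport (fun x => φ (x - a)) = (Homeomorph.subRight a) ⁻¹' tsupport φ :=
    tsupport_comp_eq_preimage φ (Homeomorph.subRight a)
  have := hg (fun x => φ (x - a)) hcomp (hc.comp_homeomorph (Homeomorph.subRight a)) (by
    rw [hts]
    intro x hx
    simpa using ha _ hx)
  simpa only [fderiv_comp_sub] using this

/-- The defining identity of weak derivatives, for a translated test function and a direction
`q`. -/
theorem setIntegral_mul_fderiv_translate {D : Set (Euc d)} (hD : Bornology.IsBounded D)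
    {f : L2 D} {g : Fin d → L2 D} (hg : ∀ i, HasWeakPartial D i f (g i))
    {φ : Euc d → ℝ} (hφ : ContDiff ℝ ∞ φ) (hc : HasCompactSupport φ) {a : Euc d}
    (ha : ∀ x ∈ tsupport φ, x + a ∈ D) (q : Euc d) :
    ∫ x in D, f x * fderiv ℝ φ (x - a) q = - ∑ i, q i * ∫ x in D, g i x * φ (x - a) := by
  have hcont : Continuous (fderiv ℝ φ) := hφ.continuous_fderiv (by simp)
  obtain ⟨C, hC⟩ := hcont.norm.bddAbove_range_of_hasCompactSupport (hc.fderiv (𝕜 := ℝ)).norm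
  have hC : ∀ x, ‖fderiv ℝ φ x‖ ≤ C := fun x => hC ⟨x, rfl⟩
  have hsub : Continuous fun x : Euc d => x - a := by fun_prop
  have hq : q = ∑ i, q i • EuclideanSpace.single i (1 : ℝ) := by
    ext j; simp [Finset.sum_apply, Pi.single_apply]
  have e : ∀ x, f x * fderiv ℝ φ (x - a) q =
      ∑ i, q i * (f x * fderiv ℝ φ (x - a) (EuclideanSpace.single i 1)) := by
    intro x
    conv_lhs => rw [hq]
    rw [map_sum, Finset.mul_sum]
    refine Finset.sum_congr rfl fun i _ => ?_
    rw [map_smul, smul_eq_mul]; ring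
  simp_rw [e]
  rw [integral_finsetSum, ← Finset.sum_neg_distrib]
  · refine Finset.sum_congr rfl fun i _ => ?_
    rw [integral_const_mul, setIntegral_mul_fderiv_translate_single (hg i) hφ hc ha, mul_neg]
  · intro i _
    refine (integrable_mul_of_bounded hD f
      (((hcont.comp hsub).clm_apply continuous_const).measurable) (c := C) fun x => ?_).const_mul _
    refine ((fderiv ℝ φ (x - a)).le_opNorm _).trans ?_
    simpa using hC (x - a)

/-! ### Second-order Taylor estimate for the sensor means -/

theorem mem_sensor {S : Set (Euc d)} {p x : Euc d} : x ∈ sensor S p ↔ x - p ∈ S :=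
  ⟨by rintro ⟨y, hy, rfl⟩; simpa using hy, fun h => ⟨x - p, h, by simp⟩⟩

theorem add_mem_of_mem_admissible {S D : Set (Euc d)} {p x : Euc d} (hp : p ∈ admissible S D)
    (hx : x ∈ S) : x + p ∈ D :=
  hp.2 (subset_closure ⟨x, hx, rfl⟩)

/-- The second weak derivative `∂ⱼ ∂ᵢ : H²(D) → L²(D)`. -/
def H2.pd2 (D : Set (Euc d)) (i j : Fin d) : H2 D →L[ℝ] L2 D :=
  (PiLp.proj 2 (fun _ : Jet d => L2 D) (.inr (.inr (i, j)))).comp (H2 D).subtypeL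

theorem H2.hasWeakPartial_val {D : Set (Euc d)} (v : H2 D) (i : Fin d) :
    HasWeakPartial D i (H2.val D v) (H2.pd D i v) := v.2.1 i

theorem H2.hasWeakPartial_pd {D : Set (Euc d)} (v : H2 D) (i j : Fin d) :
    HasWeakPartial D j (H2.pd D i v) (H2.pd2 D i j v) := v.2.2 i j

theorem H2.norm_val_le {D : Set (Euc d)} (v : H2 D) : ‖H2.val D v‖ ≤ ‖v‖ :=
  PiLp.norm_apply_le (v : PiLp 2 fun _ : Jet d => L2 D) (.inl ())

theorem H2.norm_pd_le {D : Set (Euc d)} (v : H2 D) (i : Fin d) : ‖H2.pd D i v‖ ≤ ‖v‖ :=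
  PiLp.norm_apply_le (v : PiLp 2 fun _ : Jet d => L2 D) (.inr (.inl i))

theorem H2.norm_pd2_le {D : Set (Euc d)} (v : H2 D) (i j : Fin d) : ‖H2.pd2 D i j v‖ ≤ ‖v‖ :=
  PiLp.norm_apply_le (v : PiLp 2 fun _ : Jet d => L2 D) (.inr (.inr (i, j)))

/-- Taylor estimate with the indicator function of the sensor replaced by a test function `φ`:
all derivatives are moved to `φ`, so that `t ↦ ∫ v(x) φ(x - p - t q) dx` is twice
differentiable. -/
theorem abs_testFunction_taylor_le {D S : Set (Euc d)} (hD : Bornology.IsBounded D)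
    (hS : IsOpen S) (hb : Bornology.IsBounded S) (v : H2 D) {φ : Euc d → ℝ}
    (hφ : ContDiff ℝ ∞ φ) (hc : HasCompactSupport φ) (hφS : tsupport φ ⊆ S)
    (hφ01 : ∀ x, φ x ∈ Icc (0 : ℝ) 1) {p q : Euc d}
    (hpq : ∀ s ∈ Icc (0 : ℝ) 1, p + s • q ∈ admissible S D) :
    |(∫ x in D, H2.val D v x * φ (x - (p + q))) - (∫ x in D, H2.val D v x * φ (x - p)) -
      ∑ i, q i * ∫ x in D, H2.pd D i v x * φ (x - p)| ≤
        d ^ 2 * √(volume.real S) * ‖q‖ ^ 2 * ‖v‖ := by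
  have hts : ∀ s ∈ Icc (0 : ℝ) 1, ∀ x ∈ tsupport φ, x + (p + s • q) ∈ D :=
    fun s hs x hx => add_mem_of_mem_admissible (hpq s hs) (hφS hx)
  set M : ℝ := d ^ 2 * √(volume.real S) * ‖q‖ ^ 2 * ‖v‖ with hM
  set h : ℝ → ℝ := fun t => ∫ x in D, H2.val D v x * φ (x - (p + t • q)) with hh
  set k : ℝ → ℝ := fun t => ∑ i, q i * ∫ x in D, H2.pd D i v x * φ (x - (p + t • q)) with hk
  have hqi : ∀ i, |q i| ≤ ‖q‖ := fun i => PiLp.norm_apply_le q i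
  -- `h' = k` and `k' = ∑ᵢⱼ qᵢ qⱼ ∫ ∂ⱼ∂ᵢ v φ(· - p - t q)` on `[0, 1]`
  have h1 : ∀ t ∈ Icc (0 : ℝ) 1, HasDerivAt h (k t) t := by
    intro t ht
    have := hasDerivAt_integral_translate hD (H2.val D v) hφ hc p q t
    rw [setIntegral_mul_fderiv_translate hD (H2.hasWeakPartial_val v) hφ hc (hts t ht),
      neg_neg] at this
    exact this
  have h2 : ∀ t ∈ Icc (0 : ℝ) 1, HasDerivAt k
      (∑ i, q i * ∑ j, q j * ∫ x in D, H2.pd2 D i j v x * φ (x - (p + t • q))) t := by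
    intro t ht
    refine HasDerivAt.fun_sum fun i _ => HasDerivAt.const_mul _ ?_
    have := hasDerivAt_integral_translate hD (H2.pd D i v) hφ hc p q t
    rw [setIntegral_mul_fderiv_translate hD (H2.hasWeakPartial_pd v i) hφ hc (hts t ht),
      neg_neg] at this
    exact this
  have hI : ∀ (g : L2 D) (t : ℝ), ‖g‖ ≤ ‖v‖ →
      |∫ x in D, g x * φ (x - (p + t • q))| ≤ √(volume.real S) * ‖v‖ := by
    intro g t hg
    have hA : MeasurableSet ((fun x => x - (p + t • q)) ⁻¹' S) :=
      (measurable_id.sub_const _) hS.measurableSet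
    have hvol : volume ((fun x => x - (p + t • q)) ⁻¹' S) = volume S :=
      (measurePreserving_sub_right volume _).measure_preimage hS.measurableSet.nullMeasurableSet
    have := abs_setIntegral_mul_le g (ψ := fun x => φ (x - (p + t • q)))
      (hφ.continuous.comp (by fun_prop)).measurable hA
      (by rw [hvol]; exact hb.measure_lt_top.ne) zero_le_one
      (fun x _ => by rw [abs_of_nonneg (hφ01 _).1]; exact (hφ01 _).2)
      (fun x hx => image_eq_zero_of_notMem_tsupport fun hx' => hx (hφS hx'))
    rw [one_mul, measureReal_def, hvol, ← measureReal_def] at this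
    exact this.trans (by gcongr)
  have h3 : ∀ t ∈ Icc (0 : ℝ) 1, |k t - k 0| ≤ M := by
    have hbd : ∀ t ∈ Icc (0 : ℝ) 1,
        ‖∑ i, q i * ∑ j, q j * ∫ x in D, H2.pd2 D i j v x * φ (x - (p + t • q))‖ ≤ M := by
      intro t _
      calc _ ≤ ∑ i : Fin d, ‖q‖ * ∑ j : Fin d, ‖q‖ * (√(volume.real S) * ‖v‖) := by
            refine (norm_sum_le _ _).trans (Finset.sum_le_sum fun i _ => ?_)
            rw [norm_mul]
            refine mul_le_mul (hqi i) ?_ (norm_nonneg _) (norm_nonneg _)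
            refine (norm_sum_le _ _).trans (Finset.sum_le_sum fun j _ => ?_)
            rw [norm_mul]
            exact mul_le_mul (hqi j) (hI _ _ (H2.norm_pd2_le v i j)) (norm_nonneg _) (norm_nonneg _)
        _ = M := by
            simp only [Finset.sum_const, Finset.card_univ, Fintype.card_fin, nsmul_eq_mul, hM]
            ring
    intro t ht
    have := norm_image_sub_le_of_norm_deriv_le_segment' (a := 0) (b := 1) (C := M)
      (fun t ht => (h2 t ht).hasDerivWithinAt) (fun t ht => hbd t (Ico_subset_Icc_self ht)) t ht
    refine this.trans ?_
    have hM0 : 0 ≤ M := by positivity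
    nlinarith [ht.2]
  have h4 := norm_image_sub_le_of_norm_deriv_le_segment_01' (C := M)
    (f := fun t => h t - t * k 0) (f' := fun t => k t - k 0)
    (fun t ht => by
      simpa using ((h1 t ht).fun_sub ((hasDerivAt_id' t).mul_const (k 0))).hasDerivWithinAt)
    (fun t ht => h3 t (Ico_subset_Icc_self ht))
  have e : h 1 - 1 * k 0 - (h 0 - 0 * k 0) = h 1 - h 0 - k 0 := by ring
  simp only [e, Real.norm_eq_abs] at h4
  simpa [hh, hk] using h4

/-- Taylor estimate for `p ↦ ∫_{S(p)} v dx`. -/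
theorem abs_setIntegral_sensor_taylor_le {D S : Set (Euc d)} (hD : Bornology.IsBounded D)
    (hS : IsOpen S) (hb : Bornology.IsBounded S) (v : H2 D) {p q : Euc d}
    (hpq : ∀ s ∈ Icc (0 : ℝ) 1, p + s • q ∈ admissible S D) :
    |(∫ x in sensor S (p + q), H2.val D v x ∂(volume.restrict D)) -
      (∫ x in sensor S p, H2.val D v x ∂(volume.restrict D)) -
      ∑ i, q i * ∫ x in sensor S p, H2.pd D i v x ∂(volume.restrict D)| ≤
        d ^ 2 * √(volume.real S) * ‖q‖ ^ 2 * ‖v‖ := by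
  refine le_of_forall_pos_le_add fun δ hδ => ?_
  -- replacing the indicator functions by `φ` costs at most `ε (2 + d |q|) ‖v‖ ≤ δ` for `ε = δ / N`
  set N : ℝ := (2 + d * ‖q‖) * ‖v‖ + 1 with hN
  have hN0 : 0 < N := by positivity
  obtain ⟨φ, hφ, hc, hφS, hφ01, happ⟩ :=
    exists_testFunction_approx hS hb D hD (ε := δ / N) (by positivity)
  have key := abs_testFunction_taylor_le hD hS hb v hφ hc hφS hφ01 hpq
  set ε := δ / N
  have hε0 : 0 ≤ ε := by positivity
  have hεN : ε * ((2 + d * ‖q‖) * ‖v‖) ≤ δ := by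
    calc ε * ((2 + d * ‖q‖) * ‖v‖) ≤ ε * N := by gcongr; linarith
      _ = δ := div_mul_cancel₀ _ hN0.ne'
  have a1 := (happ (H2.val D v) (p + q)).trans (mul_le_mul_of_nonneg_left (H2.norm_val_le v) hε0)
  have a2 := (happ (H2.val D v) p).trans (mul_le_mul_of_nonneg_left (H2.norm_val_le v) hε0)
  have a3 : |(∑ i, q i * ∫ x in D, H2.pd D i v x * φ (x - p)) -
      ∑ i, q i * ∫ x in sensor S p, H2.pd D i v x ∂(volume.restrict D)| ≤
      d * (‖q‖ * (ε * ‖v‖)) := by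
    rw [← Finset.sum_sub_distrib]
    calc _ ≤ ∑ i : Fin d, ‖q‖ * (ε * ‖v‖) := by
          refine (Finset.abs_sum_le_sum_abs _ _).trans (Finset.sum_le_sum fun i _ => ?_)
          rw [← mul_sub, abs_mul]
          refine mul_le_mul (PiLp.norm_apply_le q i) ?_ (abs_nonneg _) (norm_nonneg _)
          exact (happ (H2.pd D i v) p).trans (mul_le_mul_of_nonneg_left (H2.norm_pd_le v i) hε0)
      _ = _ := by simp
  rw [abs_le] at *
  constructor <;> nlinarith [a1.1, a1.2, a2.1, a2.2, a3.1, a3.2, key.1, key.2]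

/-! ### Differentiability of the sensor mean -/

theorem sensorMean_apply (D : Set (Euc d)) {S : Set (Euc d)} (hS : IsBoundedLipschitzDomain S)
    (p : Euc d) (v : H2 D) : sensorMean D hS p v =
      (volume.real S)⁻¹ * ∫ x in sensor S p, H2.val D v x ∂(volume.restrict D) := rfl

theorem sensorMeanDeriv_apply (D : Set (Euc d)) {S : Set (Euc d)}
    (hS : IsBoundedLipschitzDomain S) (p q : Euc d) (v : H2 D) : sensorMeanDeriv D hS p q v =
      (volume.real S)⁻¹ *
        ∑ i, q i * ∫ x in sensor S p, H2.pd D i v x ∂(volume.restrict D) := by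
  simp only [sensorMeanDeriv, sum_apply, Finset.mul_sum]
  refine Finset.sum_congr rfl fun i _ => ?_
  change q i * ((volume.real S)⁻¹ * ∫ x in sensor S p, H2.pd D i v x ∂(volume.restrict D)) = _
  ring

theorem sensor_subset_of_mem_admissible {S D : Set (Euc d)} {p : Euc d}
    (hp : p ∈ admissible S D) : sensor S p ⊆ D := subset_closure.trans hp.2

theorem restrict_restrict_sensor {S D : Set (Euc d)} (hS : IsBoundedLipschitzDomain S)
    {p : Euc d} (hp : p ∈ admissible S D) :
    (volume.restrict D).restrict (sensor S p) = volume.restrict (sensor S p) := by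
  rw [Measure.restrict_restrict (hS.sensor_meas p).1,
    inter_eq_left.2 (sensor_subset_of_mem_admissible hp)]

theorem norm_sensorMean_taylor_le {D S : Set (Euc d)} (hD : IsBoundedLipschitzDomain D)
    (hS : IsBoundedLipschitzDomain S) {p q : Euc d}
    (hpq : ∀ s ∈ Icc (0 : ℝ) 1, p + s • q ∈ admissible S D) :
    ‖sensorMean D hS (p + q) - sensorMean D hS p - sensorMeanDeriv D hS p q‖ ≤
      (volume.real S)⁻¹ * (d ^ 2 * √(volume.real S)) * ‖q‖ ^ 2 := by
  refine ContinuousLinearMap.opNorm_le_bound _ (by positivity) fun v => ?_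
  have := abs_setIntegral_sensor_taylor_le hD.isBounded hS.isOpen hS.isBounded v hpq
  rw [sub_apply, sub_apply, sensorMean_apply,
    sensorMean_apply, sensorMeanDeriv_apply, ← mul_sub, ← mul_sub, norm_mul, Real.norm_eq_abs,
    Real.norm_eq_abs, abs_of_nonneg (by positivity : 0 ≤ (volume.real S)⁻¹)]
  calc _ ≤ (volume.real S)⁻¹ * (d ^ 2 * √(volume.real S) * ‖q‖ ^ 2 * ‖v‖) := by gcongr
    _ = _ := by ring

theorem isOpen_admissible {S D : Set (Euc d)} (hD : IsOpen D) (hb : Bornology.IsBounded S) :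
    IsOpen (admissible S D) := by
  have hcl : ∀ p, closure (sensor S p) = (fun x => x + p) '' closure S := fun p =>
    ((Homeomorph.addRight p).image_closure S).symm
  have hK : IsCompact (closure S) := hb.isCompact_closure
  rw [isOpen_iff_mem_nhds]
  intro p hp
  have hKD : (fun x => x + p) '' closure S ⊆ D := hcl p ▸ hp.2
  have hKp : IsCompact ((fun x => x + p) '' closure S) := hK.image (by fun_prop)
  obtain ⟨δ, hδ, hsub⟩ := hKp.exists_thickening_subset_open hD hKD
  filter_upwards [Metric.ball_mem_nhds p hδ] with p' hp'
  refine ⟨?_, ?_⟩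
  · rw [hcl]; exact hK.image (by fun_prop)
  · rw [hcl]
    rintro _ ⟨x, hx, rfl⟩
    refine hsub (Metric.mem_thickening_iff.2 ⟨x + p, ⟨x, hx, rfl⟩, ?_⟩)
    simpa using hp'

theorem hasFDerivAt_sensorMean {D S : Set (Euc d)} (hD : IsBoundedLipschitzDomain D)
    (hS : IsBoundedLipschitzDomain S) {p : Euc d} (hp : p ∈ admissible S D) :
    HasFDerivAt (sensorMean D hS) (sensorMeanDeriv D hS p) p := by
  obtain ⟨r, hr, hball⟩ :=
    Metric.isOpen_iff.1 (isOpen_admissible hD.isOpen hS.isBounded) p hp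
  refine (hasFDerivAt_iff_isLittleO_nhds_zero (𝕜 := ℝ) (E := Euc d) (F := H2 D →L[ℝ] ℝ)).2 ?_
  have hO : (fun q => sensorMean D hS (p + q) - sensorMean D hS p - sensorMeanDeriv D hS p q)
      =O[𝓝 0] fun q => ‖q‖ ^ 2 := by
    refine Asymptotics.IsBigO.of_bound ((volume.real S)⁻¹ * (d ^ 2 * √(volume.real S))) ?_
    filter_upwards [Metric.ball_mem_nhds 0 hr] with q hq
    rw [Real.norm_of_nonneg (by positivity)]
    refine norm_sensorMean_taylor_le hD hS fun s hs => hball ?_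
    rw [mem_ball_iff_norm, add_sub_cancel_left, norm_smul, Real.norm_of_nonneg hs.1]
    rw [mem_ball_zero_iff] at hq
    nlinarith [hs.2, norm_nonneg q]
  refine hO.trans_isLittleO ?_
  simpa using (Asymptotics.isLittleO_norm_pow_id (E' := Euc d) one_lt_two)

/-- Since `D` is bounded, the quadratic remainder is also of order `3 / 2`. -/
theorem exists_norm_sensorMean_taylor_le_rpow {D S : Set (Euc d)}
    (hD : IsBoundedLipschitzDomain D) (hS : IsBoundedLipschitzDomain S) :
    ∃ C : ℝ, ∀ p ∈ admissible S D, ∀ q : Euc d,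
      (∀ s ∈ Icc (0 : ℝ) 1, p + s • q ∈ admissible S D) →
      ‖sensorMean D hS (p + q) - sensorMean D hS p - sensorMeanDeriv D hS p q‖ ≤
        C * ‖q‖ ^ (3 / 2 : ℝ) := by
  obtain ⟨x, hx⟩ := hS.isConnected.nonempty
  refine ⟨(volume.real S)⁻¹ * (d ^ 2 * √(volume.real S)) * Metric.diam D ^ (1 / 2 : ℝ),
    fun p hp q hpq => (norm_sensorMean_taylor_le hD hS hpq).trans ?_⟩
  have hq : ‖q‖ ≤ Metric.diam D := by
    have h0 := add_mem_of_mem_admissible hp hx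
    have h1 := add_mem_of_mem_admissible (hpq 1 (by simp)) hx
    have := Metric.dist_le_diam_of_mem hD.isBounded h1 h0
    simpa [dist_eq_norm] using this
  have e : ‖q‖ ^ 2 = ‖q‖ ^ (1 / 2 : ℝ) * ‖q‖ ^ (3 / 2 : ℝ) := by
    rw [← Real.rpow_add_of_nonneg (norm_nonneg q) (by norm_num) (by norm_num)]
    norm_num
  rw [e, mul_assoc _ (Metric.diam D ^ (1 / 2 : ℝ))]
  gcongr

end Taylor

section Embedding

variable {d : ℕ}

/-! ### Radial averages and the Sobolev embedding into continuous functions -/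

/-- A smooth antitone function on the line that is `1` on `(-∞, 0]` and `0` on `[1, ∞)`. -/
def profile (s : ℝ) : ℝ := Real.smoothTransition (1 - s)

theorem contDiff_profile : ContDiff ℝ ∞ profile :=
  Real.smoothTransition.contDiff.comp (contDiff_const.sub contDiff_id)

theorem contDiff_deriv_profile : ContDiff ℝ ∞ (deriv profile) :=
  (contDiff_infty_iff_deriv.1 contDiff_profile).2

theorem contDiff_deriv_deriv_profile : ContDiff ℝ ∞ (deriv (deriv profile)) :=
  (contDiff_infty_iff_deriv.1 contDiff_deriv_profile).2

theorem profile_of_one_le {s : ℝ} (hs : 1 ≤ s) : profile s = 0 :=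
  Real.smoothTransition.zero_of_nonpos (by linarith)

theorem deriv_eq_zero_of_one_le {h : ℝ → ℝ} (hh : ContDiff ℝ ∞ h) (h0 : ∀ s, 1 ≤ s → h s = 0)
    {s : ℝ} (hs : 1 ≤ s) : deriv h s = 0 := by
  have hcl : IsClosed {s | deriv h s = 0} :=
    isClosed_eq (hh.continuous_deriv (by simp)) continuous_const
  have hsub : Ioi (1 : ℝ) ⊆ {s | deriv h s = 0} := fun s hs => by
    have : h =ᶠ[𝓝 s] fun _ => 0 := by
      filter_upwards [Ioi_mem_nhds hs] with u hu using h0 u (le_of_lt hu)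
    simp [this.deriv_eq]
  have := hcl.closure_subset_iff.2 hsub
  rw [closure_Ioi] at this
  exact this hs

theorem deriv_profile_of_one_le {s : ℝ} (hs : 1 ≤ s) : deriv profile s = 0 :=
  deriv_eq_zero_of_one_le contDiff_profile (fun _ => profile_of_one_le) hs

theorem deriv_deriv_profile_of_one_le {s : ℝ} (hs : 1 ≤ s) : deriv (deriv profile) s = 0 :=
  deriv_eq_zero_of_one_le contDiff_deriv_profile (fun _ => deriv_profile_of_one_le) hs

theorem deriv_profile_nonpos (s : ℝ) : deriv profile s ≤ 0 := by
  have : Antitone profile := fun a b hab => Real.smoothTransition.monotone (by linarith)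
  exact this.deriv_nonpos

theorem exists_deriv_profile_ne_zero : ∃ s ∈ Ioo (0 : ℝ) 1, deriv profile s ≠ 0 := by
  obtain ⟨s, hs, h⟩ := exists_deriv_eq_slope profile zero_lt_one
    contDiff_profile.continuous.continuousOn
    (contDiff_profile.differentiable (by simp)).differentiableOn
  refine ⟨s, hs, ?_⟩
  rw [h]
  simp [profile]

/-- A continuous function on the line that vanishes on `[1, ∞)` is bounded on `[0, ∞)`. -/
theorem exists_bound_of_one_le {h : ℝ → ℝ} (hh : Continuous h) (h0 : ∀ s, 1 ≤ s → h s = 0) :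
    ∃ C, 0 ≤ C ∧ ∀ s, 0 ≤ s → |h s| ≤ C := by
  obtain ⟨C, hC⟩ := isCompact_Icc.exists_bound_of_continuousOn (s := Icc (0 : ℝ) 1)
    hh.continuousOn
  have hC0 : 0 ≤ C := (norm_nonneg _).trans (hC 0 (by simp))
  refine ⟨C, hC0, fun s hs => ?_⟩
  rcases le_total s 1 with h1 | h1
  · exact hC s ⟨hs, h1⟩
  · rw [h0 s h1, abs_zero]; exact hC0

theorem hasFDerivAt_radial {h : ℝ → ℝ} (hh : Differentiable ℝ h) (r : ℝ) (z : Euc d) :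
    HasFDerivAt (fun z : Euc d => h (‖z‖ ^ 2 / r ^ 2))
      (deriv h (‖z‖ ^ 2 / r ^ 2) • (2 / r ^ 2 : ℝ) • innerSL ℝ z) z := by
  have h1 : HasFDerivAt (fun z : Euc d => ‖z‖ ^ 2) ((2 : ℝ) • innerSL ℝ z) z := by
    have := (hasStrictFDerivAt_norm_sq z).hasFDerivAt
    rwa [two_smul ℕ, ← two_smul ℝ] at this
  have h2 := h1.mul_const (r ^ 2)⁻¹
  have h3 := (hh (‖z‖ ^ 2 / r ^ 2)).hasDerivAt.comp_hasFDerivAt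
    (f := fun z : Euc d => ‖z‖ ^ 2 / r ^ 2) z h2
  convert! h3 using 2
  rw [smul_smul, div_eq_inv_mul]

/-- The function `η` with `r⁻² η(|z|² / r²) = Δ (½ β(|z|² / r²))`, where `β` is `profile`. -/
def laplaceProfile (d : ℕ) (s : ℝ) : ℝ := d * deriv profile s + 2 * s * deriv (deriv profile) s

theorem one_le_sq_div_sq {r a : ℝ} (hr : 0 < r) (h : r ≤ a) : 1 ≤ a ^ 2 / r ^ 2 := by
  rw [one_le_div (by positivity)]; gcongr

theorem measurable_radial {h : ℝ → ℝ} (hh : Continuous h) (x : Euc d) (r : ℝ) :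
    Measurable fun y : Euc d => h (‖y - x‖ ^ 2 / r ^ 2) :=
  (hh.comp (by fun_prop)).measurable

/-- Integration by parts: the weak Laplacian is moved to the radial test function. -/
theorem setIntegral_mul_laplaceProfile {D : Set (Euc d)} (hD : Bornology.IsBounded D) (v : H2 D)
    {x : Euc d} {r : ℝ} (hr : 0 < r) (hx : Metric.closedBall x r ⊆ D) :
    ∫ y in D, H2.val D v y * laplaceProfile d (‖y - x‖ ^ 2 / r ^ 2) =
      r ^ 2 * ∑ i, ∫ y in D, H2.pd2 D i i v y * (profile (‖y - x‖ ^ 2 / r ^ 2) / 2) := by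
  set T : Euc d → ℝ := fun z => profile (‖z‖ ^ 2 / r ^ 2) / 2 with hT
  set T1 : Fin d → Euc d → ℝ := fun i z => deriv profile (‖z‖ ^ 2 / r ^ 2) * (z i / r ^ 2) with hT1
  have hcd : ∀ {h : ℝ → ℝ}, ContDiff ℝ ∞ h → ContDiff ℝ ∞ fun z : Euc d => h (‖z‖ ^ 2 / r ^ 2) :=
    fun hh => hh.comp ((contDiff_norm_sq ℝ).div_const _)
  have hcoord : ∀ i, ContDiff ℝ ∞ fun z : Euc d => z i := fun i =>
    (EuclideanSpace.proj (𝕜 := ℝ) i : Euc d →L[ℝ] ℝ).contDiff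
  have hTs : ContDiff ℝ ∞ T := (hcd contDiff_profile).div_const _
  have hT1s : ∀ i, ContDiff ℝ ∞ (T1 i) := fun i =>
    (hcd contDiff_deriv_profile).mul ((hcoord i).div_const _)
  have hts : ∀ {ψ : Euc d → ℝ}, (∀ z, r ≤ ‖z‖ → ψ z = 0) →
      tsupport ψ ⊆ Metric.closedBall 0 r := by
    intro ψ hψ
    refine closure_minimal (fun z hz => ?_) Metric.isClosed_closedBall
    rw [mem_closedBall_zero_iff]
    by_contra h
    exact hz (hψ z (le_of_not_ge h))
  have hTts : tsupport T ⊆ Metric.closedBall 0 r := hts fun z hz => by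
    simp [hT, profile_of_one_le (one_le_sq_div_sq hr hz)]
  have hT1ts : ∀ i, tsupport (T1 i) ⊆ Metric.closedBall 0 r := fun i => hts fun z hz => by
    simp [hT1, deriv_profile_of_one_le (one_le_sq_div_sq hr hz)]
  have hsubD : ∀ z ∈ Metric.closedBall (0 : Euc d) r, z + x ∈ D := fun z hz => hx (by
    rw [mem_closedBall_zero_iff] at hz
    simpa using hz)
  have hcs : ∀ {ψ : Euc d → ℝ}, tsupport ψ ⊆ Metric.closedBall 0 r → HasCompactSupport ψ :=
    fun hψ => (isCompact_closedBall _ _).of_isClosed_subset (isClosed_tsupport _) hψ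
  have hinn : ∀ (z : Euc d) i, ⟪z, EuclideanSpace.single i (1 : ℝ)⟫ = z i := fun z i => by
    simp [EuclideanSpace.inner_single_right]
  have dT : ∀ i z, fderiv ℝ T z (EuclideanSpace.single i 1) = T1 i z := by
    intro i z
    have := (hasFDerivAt_radial (contDiff_profile.differentiable (by simp)) r z).mul_const
      (2 : ℝ)⁻¹
    have e : fderiv ℝ T z = _ := HasFDerivAt.fderiv (f := T) this
    rw [e]
    simp [hinn, hT1]
    ring
  have dT1 : ∀ i z, fderiv ℝ (T1 i) z (EuclideanSpace.single i 1) =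
      (deriv (deriv profile) (‖z‖ ^ 2 / r ^ 2) * (2 * z i ^ 2 / r ^ 2) +
        deriv profile (‖z‖ ^ 2 / r ^ 2)) / r ^ 2 := by
    intro i z
    have h1 := hasFDerivAt_radial (contDiff_deriv_profile.differentiable (by simp)) r z
    have h2 : HasFDerivAt (fun z : Euc d => z i / r ^ 2) _ z :=
      ((EuclideanSpace.proj (𝕜 := ℝ) i : Euc d →L[ℝ] ℝ).hasFDerivAt (x := z)).mul_const
        (r ^ 2)⁻¹
    have e : fderiv ℝ (T1 i) z = _ := HasFDerivAt.fderiv (f := T1 i) (h1.mul h2)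
    rw [e]
    simp [hinn]
    ring
  -- integrate by parts twice, using `∂ᵢ T = T1 i`
  have e1 : ∀ i, ∫ y in D, H2.pd2 D i i v y * T (y - x) =
      ∫ y in D, H2.val D v y * fderiv ℝ (T1 i) (y - x) (EuclideanSpace.single i 1) := by
    intro i
    have a1 := setIntegral_mul_fderiv_translate_single (H2.hasWeakPartial_pd v i i) hTs
      (hcs hTts) (fun z hz => hsubD z (hTts hz))
    have a2 := setIntegral_mul_fderiv_translate_single (H2.hasWeakPartial_val v i) (hT1s i)
      (hcs (hT1ts i)) (fun z hz => hsubD z (hT1ts i hz))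
    simp only [dT] at a1
    rw [a2, a1, neg_neg]
  have hint : ∀ i, Integrable (fun y => H2.val D v y *
      fderiv ℝ (T1 i) (y - x) (EuclideanSpace.single i 1)) (volume.restrict D) := by
    intro i
    have hc : Continuous (fderiv ℝ (T1 i)) := (hT1s i).continuous_fderiv (by simp)
    obtain ⟨C, hC⟩ := hc.norm.bddAbove_range_of_hasCompactSupport
      ((hcs (hT1ts i)).fderiv (𝕜 := ℝ)).norm
    refine integrable_mul_of_bounded hD _ (c := C) ?_ fun y => ?_
    · exact ((hc.comp (by fun_prop)).clm_apply continuous_const).measurable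
    · refine ((fderiv ℝ (T1 i) (y - x)).le_opNorm _).trans ?_
      simpa using hC ⟨y - x, rfl⟩
  have e2 : ∑ i, ∫ y in D, H2.pd2 D i i v y * (profile (‖y - x‖ ^ 2 / r ^ 2) / 2) =
      ∑ i, ∫ y in D, H2.val D v y * fderiv ℝ (T1 i) (y - x) (EuclideanSpace.single i 1) :=
    Finset.sum_congr rfl fun i _ => e1 i
  rw [e2, ← integral_finsetSum _ fun i _ => hint i, ← integral_const_mul]
  refine integral_congr_ae (Eventually.of_forall fun y => ?_)
  simp only [dT1, ← Finset.mul_sum, ← Finset.sum_div, Finset.sum_add_distrib]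
  have hn : ∑ i, (y - x) i ^ 2 = ‖y - x‖ ^ 2 := by
    rw [EuclideanSpace.norm_sq_eq]; simp
  simp only [hn, laplaceProfile, Finset.sum_const, Finset.card_univ, Fintype.card_fin, nsmul_eq_mul]
  field_simp
  ring

/-- The weighted integral `r⁻ᵈ ∫_D f(y) β'(|y - x|² / r²) dy`, where `β` is `profile`. Up to the
constant factor `∫ β'(|z|²) dz`, it is an average of `f` over the ball of radius `r` about `x`. -/
def radialMean (D : Set (Euc d)) (f : L2 D) (x : Euc d) (r : ℝ) : ℝ :=
  (r ^ d)⁻¹ * ∫ y in D, f y * deriv profile (‖y - x‖ ^ 2 / r ^ 2)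

theorem hasDerivAt_radialMean {D : Set (Euc d)} (hD : Bornology.IsBounded D) (f : L2 D)
    (x : Euc d) {r : ℝ} (hr : 0 < r) :
    HasDerivAt (radialMean D f x)
      (-((r ^ (d + 1))⁻¹ * ∫ y in D, f y * laplaceProfile d (‖y - x‖ ^ 2 / r ^ 2))) r := by
  obtain ⟨C, hC0, hC⟩ := exists_bound_of_one_le (h := fun s => 2 * s * deriv (deriv profile) s)
    (by have := contDiff_deriv_deriv_profile.continuous; fun_prop)
    fun s hs => by simp [deriv_deriv_profile_of_one_le hs]
  obtain ⟨C', hC'0, hC'⟩ := exists_bound_of_one_le contDiff_deriv_profile.continuous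
    fun s hs => deriv_profile_of_one_le hs
  have : IsFiniteMeasure (volume.restrict D) := ⟨by simpa using hD.measure_lt_top⟩
  have hfi : Integrable f (volume.restrict D) := (Lp.memLp f).integrable (by norm_num)
  have hu : ∀ (y : Euc d) (s : ℝ), 0 ≤ ‖y - x‖ ^ 2 / s ^ 2 := fun y s => by positivity
  have hm1 : ∀ s : ℝ, Integrable (fun y => f y * deriv profile (‖y - x‖ ^ 2 / s ^ 2))
      (volume.restrict D) := fun s => integrable_mul_of_bounded hD f
    (measurable_radial contDiff_deriv_profile.continuous x s) fun y => hC' _ (hu y s)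
  have hc2 : Continuous fun s => 2 * s * deriv (deriv profile) s := by
    have := contDiff_deriv_deriv_profile.continuous; fun_prop
  have hm2 : Integrable (fun y => f y * (2 * (‖y - x‖ ^ 2 / r ^ 2) *
      deriv (deriv profile) (‖y - x‖ ^ 2 / r ^ 2))) (volume.restrict D) :=
    integrable_mul_of_bounded hD f (measurable_radial hc2 x r) fun y => hC _ (hu y r)
  have key : HasDerivAt (fun r => ∫ y in D, f y * deriv profile (‖y - x‖ ^ 2 / r ^ 2))
      (∫ y in D, f y * (-(2 * (‖y - x‖ ^ 2 / r ^ 2) *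
        deriv (deriv profile) (‖y - x‖ ^ 2 / r ^ 2) / r))) r := by
    refine (hasDerivAt_integral_of_dominated_loc_of_deriv_le (s := Ioi (r / 2))
      (bound := fun y => ‖f y‖ * (C * (r / 2)⁻¹))
      (F' := fun r y => f y * (-(2 * (‖y - x‖ ^ 2 / r ^ 2) *
        deriv (deriv profile) (‖y - x‖ ^ 2 / r ^ 2) / r)))
      (Ioi_mem_nhds (by linarith)) ?_ (hm1 r) ?_ ?_ ?_ ?_).2
    · exact Eventually.of_forall fun s => (hm1 s).aestronglyMeasurable
    · refine (Lp.aestronglyMeasurable f).mul ?_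
      exact ((measurable_radial hc2 x r).div_const r).neg.aestronglyMeasurable
    · refine Eventually.of_forall fun y s hs => ?_
      have hs : r / 2 < s := hs
      rw [norm_mul, norm_neg, norm_div, div_eq_mul_inv]
      gcongr
      · exact hC _ (hu y s)
      · rw [Real.norm_of_nonneg (by linarith)]; exact hs.le
    · exact hfi.norm.mul_const _
    · refine Eventually.of_forall fun y s hs => ?_
      have hs0 : 0 < s := lt_trans (by linarith) (show r / 2 < s from hs)
      have h1 : HasDerivAt (fun s : ℝ => ‖y - x‖ ^ 2 / s ^ 2)
          (-(2 * (‖y - x‖ ^ 2 / s ^ 2) / s)) s := by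
        have := (hasDerivAt_const s (‖y - x‖ ^ 2)).fun_div (hasDerivAt_pow 2 s) (by positivity)
        convert! this using 1
        field_simp
        ring
      have h2 := ((contDiff_deriv_profile.differentiable (by simp))
        (‖y - x‖ ^ 2 / s ^ 2)).hasDerivAt.comp s h1
      convert! h2.const_mul (f y) using 1
      ring
  have hpow : HasDerivAt (fun r : ℝ => (r ^ d)⁻¹) (-(d * (r ^ (d + 1))⁻¹)) r := by
    have := (hasDerivAt_pow d r).fun_inv (by positivity)
    convert! this using 1
    rcases d with _ | n
    · simp
    · simp only [Nat.add_sub_cancel]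
      field_simp
      ring
  have hprod := hpow.mul key
  have e : ∫ y in D, f y * (-(2 * (‖y - x‖ ^ 2 / r ^ 2) *
        deriv (deriv profile) (‖y - x‖ ^ 2 / r ^ 2) / r)) =
      -(r⁻¹ * ∫ y in D, f y * (2 * (‖y - x‖ ^ 2 / r ^ 2) *
        deriv (deriv profile) (‖y - x‖ ^ 2 / r ^ 2))) := by
    rw [← integral_const_mul, ← integral_neg]
    refine integral_congr_ae (Eventually.of_forall fun y => ?_)
    simp only
    ring
  have e2 : ∫ y in D, f y * laplaceProfile d (‖y - x‖ ^ 2 / r ^ 2) =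
      d * (∫ y in D, f y * deriv profile (‖y - x‖ ^ 2 / r ^ 2)) +
      ∫ y in D, f y * (2 * (‖y - x‖ ^ 2 / r ^ 2) *
        deriv (deriv profile) (‖y - x‖ ^ 2 / r ^ 2)) := by
    rw [← integral_const_mul, ← integral_add ((hm1 r).const_mul _) hm2]
    refine integral_congr_ae (Eventually.of_forall fun y => ?_)
    simp only [laplaceProfile]
    ring
  convert! hprod using 1
  rw [e, e2, pow_succ]
  generalize (∫ y in D, f y * deriv profile (‖y - x‖ ^ 2 / r ^ 2)) = I
  generalize (∫ y in D, f y * (2 * (‖y - x‖ ^ 2 / r ^ 2) *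
    deriv (deriv profile) (‖y - x‖ ^ 2 / r ^ 2))) = J
  field_simp
  ring

/-- The derivative of the radial means in `r` is `O(r ^ (1 - d / 2))`, hence integrable at `0` for
`d ≤ 3`. -/
theorem exists_abs_deriv_radialMean_le (hd : d = 2 ∨ d = 3) :
    ∃ C, 0 ≤ C ∧ ∀ (D : Set (Euc d)), Bornology.IsBounded D → ∀ (v : H2 D) (x : Euc d) (r : ℝ),
      0 < r → r ≤ 1 → Metric.closedBall x r ⊆ D →
      |(r ^ (d + 1))⁻¹ * ∫ y in D, H2.val D v y * laplaceProfile d (‖y - x‖ ^ 2 / r ^ 2)| ≤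
        C * ‖v‖ / √r := by
  set κ : ℝ := volume.real (Metric.ball (0 : Euc d) 1) with hκ
  have hκ0 : 0 ≤ κ := measureReal_nonneg
  refine ⟨d * √κ, by positivity, fun D hD v x r hr hr1 hx => ?_⟩
  rw [setIntegral_mul_laplaceProfile hD v hr hx]
  have hvol : volume.real (Metric.closedBall x r) = r ^ d * κ := by
    rw [measureReal_def, Measure.addHaar_closedBall _ _ hr.le, ENNReal.toReal_mul,
      ENNReal.toReal_ofReal (by positivity)]
    simp [hκ, measureReal_def]
  have h1 : ∀ i, |∫ y in D, H2.pd2 D i i v y * (profile (‖y - x‖ ^ 2 / r ^ 2) / 2)| ≤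
      √(r ^ d) * √κ * ‖v‖ := by
    intro i
    have := abs_setIntegral_mul_le (H2.pd2 D i i v) (A := Metric.closedBall x r)
      (ψ := fun y => profile (‖y - x‖ ^ 2 / r ^ 2) / 2)
      ((measurable_radial contDiff_profile.continuous x r).div_const 2)
      Metric.isClosed_closedBall.measurableSet measure_closedBall_lt_top.ne zero_le_one
      (fun y _ => ?_) (fun y hy => ?_)
    · rw [one_mul, hvol, Real.sqrt_mul (by positivity)] at this
      exact this.trans (by gcongr; exact H2.norm_pd2_le v i i)
    · have h0 : 0 ≤ profile (‖y - x‖ ^ 2 / r ^ 2) := Real.smoothTransition.nonneg _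
      have h1 : profile (‖y - x‖ ^ 2 / r ^ 2) ≤ 1 := Real.smoothTransition.le_one _
      rw [abs_of_nonneg (by positivity)]
      linarith
    · rw [Metric.mem_closedBall, dist_eq_norm, not_le] at hy
      simp [profile_of_one_le (one_le_sq_div_sq hr hy.le)]
  have h2 : |∑ i, ∫ y in D, H2.pd2 D i i v y * (profile (‖y - x‖ ^ 2 / r ^ 2) / 2)| ≤
      d * (√(r ^ d) * √κ * ‖v‖) := by
    refine (Finset.abs_sum_le_sum_abs _ _).trans ((Finset.sum_le_sum fun i _ => h1 i).trans ?_)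
    simp
  -- the power of `r` is `1 - d / 2`, which is at least `-1 / 2` precisely for `d ≤ 3`
  have h3 : (r ^ (d + 1))⁻¹ * r ^ 2 * √(r ^ d) ≤ 1 / √r := by
    have hs : 0 < √r := Real.sqrt_pos.2 hr
    have hss : √r * √r = r := Real.mul_self_sqrt hr.le
    have hs1 : √r ≤ 1 := Real.sqrt_le_one.2 hr1
    rw [le_div_iff₀ hs]
    rcases hd with rfl | rfl
    · rw [Real.sqrt_sq hr.le]
      have : (r ^ (2 + 1))⁻¹ * r ^ 2 * r * √r = √r := by field_simp
      rw [this]; exact hs1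
    · have e : √(r ^ 3) = r * √r := by
        rw [show r ^ 3 = r ^ 2 * r by ring, Real.sqrt_mul (by positivity), Real.sqrt_sq hr.le]
      rw [e, mul_assoc, mul_assoc r, hss]
      field_simp
      norm_num
  rw [abs_mul, abs_mul, abs_of_pos (by positivity : 0 < (r ^ (d + 1))⁻¹),
    abs_of_pos (by positivity : 0 < r ^ 2)]
  calc _ ≤ (r ^ (d + 1))⁻¹ * (r ^ 2 * (d * (√(r ^ d) * √κ * ‖v‖))) := by gcongr
    _ = ((r ^ (d + 1))⁻¹ * r ^ 2 * √(r ^ d)) * (d * √κ * ‖v‖) := by ring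
    _ ≤ (1 / √r) * (d * √κ * ‖v‖) := by gcongr
    _ = _ := by ring

theorem exists_abs_radialMean_sub_le (hd : d = 2 ∨ d = 3) :
    ∃ C, 0 ≤ C ∧ ∀ (D : Set (Euc d)), Bornology.IsBounded D → ∀ (v : H2 D) (x : Euc d) (s r : ℝ),
      0 < s → s ≤ r → r ≤ 1 → Metric.closedBall x r ⊆ D →
      |radialMean D (H2.val D v) x r - radialMean D (H2.val D v) x s| ≤ C * ‖v‖ * √r := by
  obtain ⟨C, hC0, hC⟩ := exists_abs_deriv_radialMean_le hd
  refine ⟨2 * C, by positivity, fun D hD v x s r hs hsr hr1 hx => ?_⟩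
  have hder : ∀ t ∈ Icc s r, HasDerivAt (radialMean D (H2.val D v) x)
      (-((t ^ (d + 1))⁻¹ * ∫ y in D, H2.val D v y * laplaceProfile d (‖y - x‖ ^ 2 / t ^ 2))) t :=
    fun t ht => hasDerivAt_radialMean hD _ x (hs.trans_le ht.1)
  have hB : ∀ t ∈ Icc s r, HasDerivAt (fun t => 2 * C * ‖v‖ * (√t - √s)) (C * ‖v‖ / √t) t := by
    intro t ht
    have h := ((Real.hasDerivAt_sqrt (hs.trans_le ht.1).ne').sub_const (√s)).const_mul
      (2 * C * ‖v‖)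
    convert! h using 1
    ring
  have := image_norm_le_of_norm_deriv_right_le_deriv_boundary' (a := s) (b := r)
    (f := fun t => radialMean D (H2.val D v) x t - radialMean D (H2.val D v) x s)
    (fun t ht => ((hder t ht).sub_const _).continuousAt.continuousWithinAt)
    (fun t ht => ((hder t (Ico_subset_Icc_self ht)).sub_const _).hasDerivWithinAt)
    (by simp) (fun t ht => (hB t ht).continuousAt.continuousWithinAt)
    (fun t ht => (hB t (Ico_subset_Icc_self ht)).hasDerivWithinAt)
    (fun t ht => by
      rw [norm_neg]
      exact hC D hD v x t (hs.trans_le ht.1) (ht.2.le.trans hr1)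
        ((Metric.closedBall_subset_closedBall ht.2.le).trans hx))
    (right_mem_Icc.2 hsr)
  refine this.trans ?_
  gcongr
  linarith [Real.sqrt_nonneg s]

theorem continuous_radialMean {D : Set (Euc d)} (hD : Bornology.IsBounded D) (f : L2 D) (r : ℝ) :
    Continuous fun x => radialMean D f x r := by
  obtain ⟨C, hC0, hC⟩ := exists_bound_of_one_le contDiff_deriv_profile.continuous
    fun s hs => deriv_profile_of_one_le hs
  have : IsFiniteMeasure (volume.restrict D) := ⟨by simpa using hD.measure_lt_top⟩
  have hfi : Integrable f (volume.restrict D) := (Lp.memLp f).integrable (by norm_num)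
  refine continuous_const.mul (continuous_of_dominated (bound := fun y => ‖f y‖ * C) ?_ ?_ ?_ ?_)
  · exact fun x => (Lp.aestronglyMeasurable f).mul
      (measurable_radial contDiff_deriv_profile.continuous x r).aestronglyMeasurable
  · refine fun x => Eventually.of_forall fun y => ?_
    rw [norm_mul]
    gcongr
    exact hC _ (by positivity)
  · exact hfi.norm.mul_const C
  · refine Eventually.of_forall fun y => ?_
    have := contDiff_deriv_profile.continuous
    fun_prop

theorem integral_deriv_profile_neg (hd : 0 < d) :
    ∫ z : Euc d, deriv profile (‖z‖ ^ 2) < 0 := by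
  have hc : Continuous fun z : Euc d => -deriv profile (‖z‖ ^ 2) := by
    have := contDiff_deriv_profile.continuous
    fun_prop
  obtain ⟨s, hs, hne⟩ := exists_deriv_profile_ne_zero
  have hcs : HasCompactSupport fun z : Euc d => -deriv profile (‖z‖ ^ 2) := by
    refine HasCompactSupport.intro (isCompact_closedBall 0 1) fun z hz => ?_
    rw [mem_closedBall_zero_iff, not_le] at hz
    rw [deriv_profile_of_one_le (by nlinarith), neg_zero]
  have := hc.integral_pos_of_hasCompactSupport_nonneg_nonzero (μ := volume) hcs
    (fun z => neg_nonneg.2 (deriv_profile_nonpos _))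
    (x := EuclideanSpace.single ⟨0, hd⟩ (√s)) (by
      simpa [Real.sq_sqrt hs.1.le] using hne)
  rw [integral_neg] at this
  linarith

/-- At Lebesgue points of `f`, the normalized radial means converge to `f`. -/
theorem ae_tendsto_radialMean {D : Set (Euc d)} (hd : 0 < d) (hD : IsOpen D)
    (hb : Bornology.IsBounded D) (f : L2 D) :
    ∀ᵐ x ∂(volume.restrict D), Tendsto (fun n : ℕ => (∫ z : Euc d, deriv profile (‖z‖ ^ 2))⁻¹ *
      radialMean D f x (1 / ((n : ℝ) + 1))) atTop (𝓝 (f x)) := by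
  set c := ∫ z : Euc d, deriv profile (‖z‖ ^ 2) with hc
  have hc0 : c ≠ 0 := (integral_deriv_profile_neg hd).ne
  obtain ⟨C, hC0, hC⟩ := exists_bound_of_one_le contDiff_deriv_profile.continuous
    fun s hs => deriv_profile_of_one_le hs
  have : IsFiniteMeasure (volume.restrict D) := ⟨by simpa using hb.measure_lt_top⟩
  have hfi : IntegrableOn f D := (Lp.memLp f).integrable (by norm_num)
  have hg : Integrable (D.indicator f) := (integrable_indicator_iff hD.measurableSet).2 hfi
  have hleb := (Besicovitch.vitaliFamily (volume : Measure (Euc d))).ae_tendsto_average_norm_sub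
    hg.locallyIntegrable
  filter_upwards [ae_restrict_of_ae hleb, ae_restrict_mem hD.measurableSet] with x hx hxD
  set r : ℕ → ℝ := fun n => 1 / ((n : ℝ) + 1) with hr
  have hr0 : ∀ n, 0 < r n := fun n => by positivity
  have hrt : Tendsto r atTop (𝓝[>] 0) := tendsto_nhdsWithin_iff.2
    ⟨tendsto_one_div_add_atTop_nhds_zero_nat, Eventually.of_forall hr0⟩
  have hx' := (hx.comp (Besicovitch.tendsto_filterAt volume x)).comp hrt
  set κ : ℝ := volume.real (Metric.ball (0 : Euc d) 1) with hκ
  have hκ0 : 0 < κ :=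
    ENNReal.toReal_pos (Metric.measure_ball_pos volume _ one_pos).ne' measure_ball_lt_top.ne
  have hvol : ∀ n, volume.real (Metric.closedBall x (r n)) = r n ^ d * κ := by
    intro n
    rw [measureReal_def, Measure.addHaar_closedBall _ _ (hr0 n).le, ENNReal.toReal_mul,
      ENNReal.toReal_ofReal (by have := hr0 n; positivity)]
    simp [hκ, measureReal_def]
  have key := tendsto_integral_smul_of_tendsto_average_norm_sub
    (g := fun n y => c⁻¹ * ((r n ^ d)⁻¹ * deriv profile (‖y - x‖ ^ 2 / r n ^ 2)))
    (|c⁻¹| * C * κ) hx' ?_ ?_ ?_ ?_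
  · rw [indicator_of_mem hxD] at key
    refine key.congr fun n => ?_
    rw [radialMean, ← integral_indicator hD.measurableSet, ← integral_const_mul,
      ← integral_const_mul]
    refine integral_congr_ae (Eventually.of_forall fun y => ?_)
    by_cases hy : y ∈ D
    · simp only [hy, indicator_of_mem, smul_eq_mul, hr]; ring
    · simp [hy]
  · exact Eventually.of_forall fun n => hg.integrableOn
  · refine tendsto_const_nhds.congr fun n => ?_
    rw [integral_const_mul, integral_const_mul]
    have e : ∫ y, deriv profile (‖y - x‖ ^ 2 / r n ^ 2) = r n ^ d * c := by
      rw [integral_sub_right_eq_self (fun y : Euc d => deriv profile (‖y‖ ^ 2 / r n ^ 2)) x]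
      have := Measure.integral_comp_inv_smul (μ := (volume : Measure (Euc d)))
        (fun z : Euc d => deriv profile (‖z‖ ^ 2)) (r n)
      rw [abs_of_nonneg (by have := hr0 n; positivity), smul_eq_mul, finrank_euclideanSpace_fin]
        at this
      rw [hc, ← this]
      refine integral_congr_ae (Eventually.of_forall fun y => ?_)
      simp only [norm_smul, norm_inv, Real.norm_of_nonneg (hr0 n).le, mul_pow, inv_pow]
      rw [div_eq_inv_mul]
    rw [e, inv_mul_cancel_left₀ (pow_ne_zero _ (hr0 n).ne'), inv_mul_cancel₀ hc0]
  · refine Eventually.of_forall fun n y hy => ?_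
    rw [Metric.mem_closedBall, dist_eq_norm]
    by_contra h
    refine hy ?_
    simp [deriv_profile_of_one_le (one_le_sq_div_sq (hr0 n) (not_le.1 h).le)]
  · refine Eventually.of_forall fun n y => ?_
    have hrd : 0 < r n ^ d := pow_pos (hr0 n) _
    rw [hvol, abs_mul, abs_mul, abs_of_pos (inv_pos.2 hrd)]
    have e : |c⁻¹| * C * κ / (r n ^ d * κ) = |c⁻¹| * ((r n ^ d)⁻¹ * C) := by field_simp
    rw [e]
    gcongr
    exact hC _ (by positivity)

/-- The Sobolev embedding `H²(D) ⊆ C(D)` for `d ≤ 3`: every `v ∈ H²(D)` has a representative that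
is continuous in `D`. -/
theorem exists_continuousOn_representative (hd : d = 2 ∨ d = 3) {D : Set (Euc d)}
    (hD : IsOpen D) (hb : Bornology.IsBounded D) (v : H2 D) :
    ∃ w : Euc d → ℝ, ContinuousOn w D ∧ H2.val D v =ᵐ[volume.restrict D] w := by
  obtain ⟨C, hC0, hC⟩ := exists_abs_radialMean_sub_le hd
  set c := ∫ z : Euc d, deriv profile (‖z‖ ^ 2) with hc
  set r : ℕ → ℝ := fun n => 1 / ((n : ℝ) + 1) with hr
  have hr0 : ∀ n, 0 < r n := fun n => by positivity
  have hr1 : ∀ n, r n ≤ 1 := fun n => by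
    rw [hr]; exact (div_le_one (by positivity)).2 (by linarith [n.cast_nonneg (α := ℝ)])
  have hanti : ∀ {m n}, m ≤ n → r n ≤ r m := fun {m n} h => Nat.one_div_le_one_div h
  have hrt : Tendsto r atTop (𝓝 0) := tendsto_one_div_add_atTop_nhds_zero_nat
  set M : ℕ → Euc d → ℝ := fun n x => c⁻¹ * radialMean D (H2.val D v) x (r n) with hM
  have hcauchy : ∀ x n, Metric.closedBall x (r n) ⊆ D → ∀ k, n ≤ k →
      |M n x - M k x| ≤ |c⁻¹| * (C * ‖v‖ * √(r n)) := by
    intro x n hx k hk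
    rw [hM, ← mul_sub, abs_mul]
    gcongr
    exact hC D hb v x _ _ (hr0 k) (hanti hk) (hr1 n) hx
  have hδ : Tendsto (fun n => |c⁻¹| * (C * ‖v‖ * √(r n))) atTop (𝓝 0) := by
    have : Tendsto (fun n => √(r n)) atTop (𝓝 0) := by
      have h := (Real.continuous_sqrt.tendsto 0).comp hrt
      rwa [Real.sqrt_zero] at h
    simpa using (this.const_mul (C * ‖v‖)).const_mul |c⁻¹|
  -- around every point of `D` the radii `r n` are eventually uniformly admissible
  have hloc : ∀ x₀ ∈ D, ∃ ρ > 0, ∃ N, ∀ n ≥ N, ∀ x ∈ Metric.ball x₀ ρ,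
      Metric.closedBall x (r n) ⊆ D := by
    intro x₀ hx₀
    obtain ⟨ρ, hρ, hsub⟩ := Metric.isOpen_iff.1 hD x₀ hx₀
    obtain ⟨N, hN⟩ := eventually_atTop.1 ((tendsto_order.1 hrt).2 (ρ / 2) (by linarith))
    refine ⟨ρ / 2, by linarith, N, fun n hn x hx => ?_⟩
    refine (fun y hy => hsub ?_)
    rw [Metric.mem_ball] at hx ⊢
    rw [Metric.mem_closedBall] at hy
    linarith [dist_triangle y x x₀, hN n hn]
  have hlim : ∀ x ∈ D, ∃ l, Tendsto (fun n => M n x) atTop (𝓝 l) := by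
    intro x hx
    obtain ⟨ρ, hρ, N, hN⟩ := hloc x hx
    refine cauchySeq_tendsto_of_complete (Metric.cauchySeq_iff'.2 fun ε hε => ?_)
    obtain ⟨n, hn, hnN⟩ := (((tendsto_order.1 hδ).2 ε hε).and (eventually_ge_atTop N)).exists
    refine ⟨n, fun k hk => ?_⟩
    rw [Real.dist_eq, abs_sub_comm]
    exact (hcauchy x n (hN n hnN x (Metric.mem_ball_self hρ)) k hk).trans_lt hn
  choose! w hw using hlim
  refine ⟨w, fun x₀ hx₀ => ?_, ?_⟩
  · obtain ⟨ρ, hρ, N, hN⟩ := hloc x₀ hx₀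
    have hball : Metric.ball x₀ ρ ∈ 𝓝 x₀ := Metric.ball_mem_nhds _ hρ
    have hunif : TendstoUniformlyOn M w atTop (Metric.ball x₀ ρ ∩ D) := by
      refine Metric.tendstoUniformlyOn_iff.2 fun ε hε => ?_
      filter_upwards [(tendsto_order.1 hδ).2 ε hε, eventually_ge_atTop N] with n hn hnN x hx
      rw [dist_comm, Real.dist_eq]
      refine (le_of_tendsto ((tendsto_const_nhds.sub (hw x hx.2)).abs) ?_).trans_lt hn
      filter_upwards [eventually_ge_atTop n] with k hk
      exact hcauchy x n (hN n hnN x hx.1) k hk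
    have hcont : ContinuousOn w (Metric.ball x₀ ρ ∩ D) :=
      hunif.continuousOn (Frequently.of_forall fun n =>
        (continuous_const.mul (continuous_radialMean hb _ _)).continuousOn)
    exact (hcont.continuousAt (inter_mem hball (hD.mem_nhds hx₀))).continuousWithinAt
  · filter_upwards [ae_tendsto_radialMean (by omega) hD hb (H2.val D v),
      ae_restrict_mem hD.measurableSet] with x hx hxD
    exact tendsto_nhds_unique hx (hw x hxD)

end Embedding

/-! ### The area formula for Lipschitz graphs -/

section Graph

open scoped NNReal

/-- Comparison of the Hausdorff measures of two images of the same set: the hypothesis makes `f`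
factor through `g` on `s`, by a `C`-Lipschitz map on `g '' s`. -/
theorem euclideanHausdorffMeasure_image_le_of_dist_le {X Y : Type*} [MetricSpace Y]
    [MeasurableSpace Y] [BorelSpace Y] {Z : Type*} [MetricSpace Z] [MeasurableSpace Z]
    [BorelSpace Z] {f : X → Y} {g : X → Z} {s : Set X} {C : ℝ≥0}
    (h : ∀ x ∈ s, ∀ y ∈ s, dist (f x) (f y) ≤ C * dist (g x) (g y)) (k : ℕ) :
    Measure.euclideanHausdorffMeasure k (f '' s) ≤
      (C : ℝ≥0∞) ^ k * Measure.euclideanHausdorffMeasure k (g '' s) := by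
  rcases isEmpty_or_nonempty X with hX | hX
  · have : s = ∅ := Subsingleton.elim _ _
    simp [this]
  set i : Z → X := Function.invFunOn g s with hi
  have hmem : ∀ x ∈ s, i (g x) ∈ s := fun x hx => Function.invFunOn_mem ⟨x, hx, rfl⟩
  have heq : ∀ x ∈ s, g (i (g x)) = g x := fun x hx => Function.invFunOn_eq ⟨x, hx, rfl⟩
  have hf : ∀ x ∈ s, f (i (g x)) = f x := fun x hx => by
    have := h _ (hmem x hx) _ hx
    rw [heq x hx, dist_self, mul_zero] at this
    exact dist_le_zero.1 this
  have hlip : LipschitzOnWith C (f ∘ i) (g '' s) := by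
    refine LipschitzOnWith.of_dist_le_mul ?_
    rintro _ ⟨x, hx, rfl⟩ _ ⟨y, hy, rfl⟩
    simpa [hf x hx, hf y hy] using h x hx y hy
  have himg : (f ∘ i) '' (g '' s) = f '' s := by
    rw [image_image]
    exact image_congr fun x hx => hf x hx
  have key := hlip.hausdorffMeasure_image_le (d := k) (by positivity)
  rw [himg, ENNReal.rpow_natCast] at key
  simp only [Measure.euclideanHausdorffMeasure_def, Measure.smul_apply,
    Measure.nnreal_smul_coe_apply]
  calc _ ≤ _ := mul_le_mul_right key _
    _ = _ := by ring

variable {F E : Type*} [NormedAddCommGroup F] [InnerProductSpace ℝ F] [NormedAddCommGroup E]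
  [InnerProductSpace ℝ E]

/-- The parametrization `y ↦ (y, γ y)` of the graph of `γ`, in the orthogonal coordinates given by
the linear isometry `P`. -/
def graphMap (P : WithLp 2 (F × ℝ) ≃ₗᵢ[ℝ] E) (γ : F → ℝ) (y : F) : E :=
  P (WithLp.toLp 2 (y, γ y))

/-- The area density `√(1 + |∇γ|²)` of the graph of `γ`. -/
def graphDensity (γ : F → ℝ) (y : F) : ℝ := √(1 + ‖fderiv ℝ γ y‖ ^ 2)

theorem norm_toLp_sq (P : WithLp 2 (F × ℝ) ≃ₗᵢ[ℝ] E) (y : F) (t : ℝ) :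
    ‖P (WithLp.toLp 2 (y, t))‖ ^ 2 = ‖y‖ ^ 2 + t ^ 2 := by
  rw [P.norm_map, WithLp.prod_norm_sq_eq_of_L2]
  simp

theorem graphMap_sub (P : WithLp 2 (F × ℝ) ≃ₗᵢ[ℝ] E) (γ : F → ℝ) (y z : F) :
    graphMap P γ y - graphMap P γ z = P (WithLp.toLp 2 (y - z, γ y - γ z)) := by
  rw [graphMap, graphMap, ← map_sub]; rfl

theorem dist_le_dist_graphMap (P : WithLp 2 (F × ℝ) ≃ₗᵢ[ℝ] E) (γ : F → ℝ) (y z : F) :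
    dist y z ≤ dist (graphMap P γ y) (graphMap P γ z) := by
  rw [dist_eq_norm, dist_eq_norm, graphMap_sub]
  refine le_of_sq_le_sq ?_ (norm_nonneg _)
  rw [norm_toLp_sq]
  nlinarith [sq_nonneg (γ y - γ z)]

/-- Two graphs over the same set, whose height functions differ by a `δ`-Lipschitz function, are
`(1 + δ)`-bi-Lipschitz images of each other. -/
theorem dist_graphMap_le (P : WithLp 2 (F × ℝ) ≃ₗᵢ[ℝ] E) (γ γ' : F → ℝ) {δ : ℝ} (hδ : 0 ≤ δ)
    {y z : F} (h : |γ y - γ z - (γ' y - γ' z)| ≤ δ * ‖y - z‖) :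
    dist (graphMap P γ y) (graphMap P γ z) ≤
      (1 + δ) * dist (graphMap P γ' y) (graphMap P γ' z) := by
  have h1 := dist_le_dist_graphMap P γ' y z
  rw [dist_eq_norm] at h1
  have e : graphMap P γ y - graphMap P γ z = (graphMap P γ' y - graphMap P γ' z) +
      P (WithLp.toLp 2 (0, γ y - γ z - (γ' y - γ' z))) := by
    rw [graphMap_sub, graphMap_sub, ← map_add, ← WithLp.toLp_add]
    simp
  have h2 : ‖P (WithLp.toLp 2 ((0 : F), γ y - γ z - (γ' y - γ' z)))‖ ≤ δ * ‖y - z‖ := by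
    refine le_trans (le_of_eq ?_) h
    rw [← sq_eq_sq₀ (norm_nonneg _) (abs_nonneg _), norm_toLp_sq]
    simp
  rw [dist_eq_norm, e]
  refine (norm_add_le _ _).trans ?_
  rw [← dist_eq_norm]
  nlinarith

theorem continuous_graphMap (P : WithLp 2 (F × ℝ) ≃ₗᵢ[ℝ] E) {γ : F → ℝ} (hγ : Continuous γ) :
    Continuous (graphMap P γ) :=
  P.continuous.comp ((WithLp.prod_continuous_toLp 2 F ℝ).comp (continuous_id.prodMk hγ))

theorem isClosedEmbedding_graphMap (P : WithLp 2 (F × ℝ) ≃ₗᵢ[ℝ] E) {γ : F → ℝ}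
    (hγ : Continuous γ) : IsClosedEmbedding (graphMap P γ) := by
  have hanti : AntilipschitzWith 1 (graphMap P γ) := AntilipschitzWith.of_le_mul_dist fun y z => by
    simpa using dist_le_dist_graphMap P γ y z
  refine IsClosedEmbedding.of_continuous_injective_isClosedMap (continuous_graphMap P hγ)
    hanti.injective fun s hs => ?_
  have e : graphMap P γ '' s = {x | (P.symm x).fst ∈ s ∧ γ (P.symm x).fst = (P.symm x).snd} := by
    ext x
    constructor
    · rintro ⟨y, hy, rfl⟩
      simpa [graphMap] using hy
    · rintro ⟨h1, h2⟩
      refine ⟨_, h1, ?_⟩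
      rw [graphMap, h2]
      exact P.apply_symm_apply x
  have hc1 : Continuous fun x => (P.symm x).fst := by fun_prop
  have hc2 : Continuous fun x => (P.symm x).snd := by fun_prop
  rw [e]
  exact (hs.preimage hc1).inter (isClosed_eq (hγ.comp hc1) hc2)

variable [FiniteDimensional ℝ F] [MeasurableSpace F] [BorelSpace F] [FiniteDimensional ℝ E]
  [MeasurableSpace E] [BorelSpace E]

/-- The graph of a linear function `L` has the area density `√(1 + |L|²)`. -/
theorem euclideanHausdorffMeasure_graphMap_linear (P : WithLp 2 (F × ℝ) ≃ₗᵢ[ℝ] E) (L : F →L[ℝ] ℝ)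
    (s : Set F) :
    Measure.euclideanHausdorffMeasure (Module.finrank ℝ F) (graphMap P L '' s) =
      ENNReal.ofReal √(1 + ‖L‖ ^ 2) * volume s := by
  set A : F →ₗ[ℝ] E :=
    { toFun := graphMap P L
      map_add' := fun y z => by
        rw [graphMap, graphMap, graphMap, ← map_add, ← WithLp.toLp_add]; simp
      map_smul' := fun c y => by
        simp only [graphMap, RingHom.id_apply]
        rw [← map_smul, ← WithLp.toLp_smul]; simp } with hA
  set a : F := (InnerProductSpace.toDual ℝ F).symm L with ha
  have hLa : ∀ y, L y = ⟪a, y⟫ := fun y => by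
    rw [ha, InnerProductSpace.toDual_symm_apply]
  have hna : ‖a‖ = ‖L‖ := by rw [ha, LinearIsometryEquiv.norm_map]
  -- `A* A = 1 + a ⊗ a`, so that the Gram determinant is `1 + |a|²`
  have hadj : A.adjoint ∘ₗ A = LinearMap.transvection (innerₗ F a) a := by
    ext x
    refine ext_inner_right ℝ fun z => ?_
    rw [LinearMap.comp_apply, LinearMap.adjoint_inner_left, LinearMap.transvection.apply,
      inner_add_left]
    change ⟪P _, P _⟫ = _
    rw [P.inner_map_map]
    simp [WithLp.prod_inner_apply, hLa, inner_smul_left, mul_comm]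
  have hdet : A.normDet = √(1 + ‖L‖ ^ 2) := by
    have h := A.normDet_sq
    rw [hadj, LinearMap.transvection.det] at h
    rw [eq_comm, Real.sqrt_eq_iff_mul_self_eq_of_pos, ← pow_two]
    · simpa [hna] using h
    · have h1 : 0 < A.normDet ^ 2 := by
        have h' : A.normDet ^ 2 = 1 + ‖a‖ ^ 2 := by simpa using h
        rw [h']; positivity
      exact lt_of_le_of_ne A.normDet_nonneg (fun h0 => by rw [← h0] at h1; simp at h1)
  have := A.euclideanHausdorffMeasure_image_eq_normDet_mul_volume s
  rw [hdet] at this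
  exact this

end Graph

section Graph

open scoped NNReal

theorem sqrt_one_add_sq_le {a b δ : ℝ} (ha : 0 ≤ a) (hδ : 0 ≤ δ) (h : a ≤ b + δ) :
    √(1 + a ^ 2) ≤ (1 + δ) * √(1 + b ^ 2) := by
  have h1 : 1 ≤ √(1 + b ^ 2) := Real.one_le_sqrt.2 (by nlinarith)
  have h2 : b ≤ √(1 + b ^ 2) := Real.le_sqrt_of_sq_le (by linarith)
  have h3 : √(1 + b ^ 2) ^ 2 = 1 + b ^ 2 := Real.sq_sqrt (by positivity)
  refine Real.sqrt_le_iff.2 ⟨by positivity, ?_⟩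
  set R := √(1 + b ^ 2)
  have h4 : a ^ 2 ≤ (b + δ) ^ 2 := by gcongr
  nlinarith [mul_nonneg hδ (sub_nonneg.2 h2), mul_nonneg (sq_nonneg δ) (sq_nonneg R),
    mul_nonneg hδ (sub_nonneg.2 h1), mul_nonneg (mul_nonneg hδ (sub_nonneg.2 h1)) (sub_nonneg.2 h1),
    mul_nonneg (sq_nonneg δ) (sub_nonneg.2 h1), sq_nonneg (δ * (R - 1)),
    mul_nonneg hδ (mul_nonneg (by linarith : (0 : ℝ) ≤ R) (sub_nonneg.2 h2))]

variable {F E : Type*} [NormedAddCommGroup F] [InnerProductSpace ℝ F]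

theorem one_le_graphDensity (γ : F → ℝ) (y : F) : 1 ≤ graphDensity γ y :=
  Real.one_le_sqrt.2 (by nlinarith [sq_nonneg ‖fderiv ℝ γ y‖])

variable [MeasurableSpace F] [BorelSpace F]

theorem measurable_graphDensity (γ : F → ℝ) : Measurable (graphDensity γ) := by
  have := (measurable_fderiv ℝ γ).norm
  exact ((this.pow_const 2).const_add 1).sqrt

variable [FiniteDimensional ℝ F]

/-- On a set where a scalar function is well approximated by a linear form `A`, its derivative is
close to `A` almost everywhere. -/
theorem ae_norm_fderiv_sub_le [Nontrivial F] {γ : F → ℝ} {A : F →L[ℝ] ℝ} {δ : ℝ≥0} {s : Set F}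
    (h : ApproximatesLinearOn γ A s δ) (hs : MeasurableSet s)
    (hd : ∀ y ∈ s, DifferentiableAt ℝ γ y) :
    ∀ᵐ y ∂(volume.restrict s), ‖fderiv ℝ γ y - A‖ ≤ δ := by
  -- Mathlib has the statement for maps `F → F`; apply it to `γ u` with a unit vector `u`
  obtain ⟨u, hu⟩ := exists_norm_eq F zero_le_one
  have h' : ApproximatesLinearOn (fun y => γ y • u) (A.smulRight u) s δ := by
    intro y hy z hz
    have := h y hy z hz
    have e : γ y • u - γ z • u - A.smulRight u (y - z) = (γ y - γ z - A (y - z)) • u := by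
      simp [sub_smul]
    rw [e, norm_smul, hu, mul_one]
    exact this
  filter_upwards [h'.norm_fderiv_sub_le volume hs (fun y => (fderiv ℝ γ y).smulRight u)
    fun y hy => ((hd y hy).hasFDerivAt.smul_const u).hasFDerivWithinAt] with y hy
  have e : (fderiv ℝ γ y).smulRight u - A.smulRight u = (fderiv ℝ γ y - A).smulRight u := by
    ext z; simp [sub_smul]
  rw [e] at hy
  have hy : ‖(fderiv ℝ γ y - A).smulRight u‖ ≤ δ := hy
  rwa [ContinuousLinearMap.norm_smulRight_apply, hu, mul_one] at hy

variable [NormedAddCommGroup E] [InnerProductSpace ℝ E] [MeasurableSpace E] [BorelSpace E]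

/-- Two-sided area estimate on a set where `γ` is nearly linear. -/
theorem area_estimate_of_approximatesLinearOn [FiniteDimensional ℝ E] [Nontrivial F]
    (P : WithLp 2 (F × ℝ) ≃ₗᵢ[ℝ] E)
    {γ : F → ℝ} {A : F →L[ℝ] ℝ} {δ : ℝ≥0} {s : Set F} (h : ApproximatesLinearOn γ A s δ)
    (hs : MeasurableSet s) (hd : ∀ y ∈ s, DifferentiableAt ℝ γ y) :
    Measure.euclideanHausdorffMeasure (Module.finrank ℝ F) (graphMap P γ '' s) ≤
        ((1 + δ : ℝ≥0) : ℝ≥0∞) ^ (Module.finrank ℝ F + 1) *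
          ∫⁻ y in s, ENNReal.ofReal (graphDensity γ y) ∧
      ∫⁻ y in s, ENNReal.ofReal (graphDensity γ y) ≤
        ((1 + δ : ℝ≥0) : ℝ≥0∞) ^ (Module.finrank ℝ F + 1) *
          Measure.euclideanHausdorffMeasure (Module.finrank ℝ F) (graphMap P γ '' s) := by
  set k := Module.finrank ℝ F
  set c : ℝ≥0∞ := ((1 + δ : ℝ≥0) : ℝ≥0∞) with hc
  have hcR : c = ENNReal.ofReal (1 + δ) := by
    rw [hc, ← ENNReal.ofReal_coe_nnreal]; push_cast; rfl
  have hae := ae_norm_fderiv_sub_le h hs hd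
  have happ : ∀ x ∈ s, ∀ y ∈ s, |γ x - γ y - (A x - A y)| ≤ δ * ‖x - y‖ := fun x hx y hy => by
    rw [← map_sub]; exact h x hx y hy
  have hlin := euclideanHausdorffMeasure_graphMap_linear P A s
  set J := √(1 + ‖A‖ ^ 2)
  have h1 : Measure.euclideanHausdorffMeasure k (graphMap P γ '' s) ≤
      c ^ k * (ENNReal.ofReal J * volume s) := by
    rw [← hlin]
    refine euclideanHausdorffMeasure_image_le_of_dist_le (fun x hx y hy => ?_) k
    simpa using dist_graphMap_le P γ A δ.2 (happ x hx y hy)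
  have h2 : ENNReal.ofReal J * volume s ≤
      c ^ k * Measure.euclideanHausdorffMeasure k (graphMap P γ '' s) := by
    rw [← hlin]
    refine euclideanHausdorffMeasure_image_le_of_dist_le (fun x hx y hy => ?_) k
    have h' := happ x hx y hy
    rw [abs_sub_comm] at h'
    simpa using dist_graphMap_le P A γ δ.2 h'
  have h3 : ENNReal.ofReal J * volume s ≤ c * ∫⁻ y in s, ENNReal.ofReal (graphDensity γ y) := by
    rw [← setLIntegral_const, ← lintegral_const_mul' _ _ (by simp [hc])]
    refine lintegral_mono_ae ?_
    filter_upwards [hae] with y hy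
    rw [hcR, ← ENNReal.ofReal_mul (by positivity)]
    refine ENNReal.ofReal_le_ofReal (sqrt_one_add_sq_le (norm_nonneg _) δ.coe_nonneg ?_)
    rw [norm_sub_rev] at hy
    linarith [norm_sub_norm_le A (fderiv ℝ γ y)]
  have h4 : ∫⁻ y in s, ENNReal.ofReal (graphDensity γ y) ≤ c * (ENNReal.ofReal J * volume s) := by
    rw [← setLIntegral_const, ← lintegral_const_mul' _ _ (by simp [hc])]
    refine lintegral_mono_ae ?_
    filter_upwards [hae] with y hy
    rw [hcR, ← ENNReal.ofReal_mul (by positivity)]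
    refine ENNReal.ofReal_le_ofReal (sqrt_one_add_sq_le (norm_nonneg _) δ.coe_nonneg ?_)
    linarith [norm_sub_norm_le (fderiv ℝ γ y) A]
  constructor
  · refine h1.trans ?_
    rw [pow_succ, mul_assoc]
    gcongr
  · refine h4.trans ?_
    rw [pow_succ', mul_assoc]
    gcongr

theorem euclideanHausdorffMeasure_graphMap_null (P : WithLp 2 (F × ℝ) ≃ₗᵢ[ℝ] E) {γ : F → ℝ}
    {K : ℝ≥0} (hγ : LipschitzWith K γ) {s : Set F} (hs : volume s = 0) :
    Measure.euclideanHausdorffMeasure (Module.finrank ℝ F) (graphMap P γ '' s) = 0 := by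
  have h := euclideanHausdorffMeasure_image_le_of_dist_le (f := graphMap P γ) (g := id) (s := s)
    (C := 1 + K) (fun x _ y _ => ?_) (Module.finrank ℝ F)
  · rw [image_id, InnerProductSpace.euclideanHausdorffMeasure_eq_volume, hs, mul_zero] at h
    exact le_antisymm h bot_le
  · have h1 := dist_graphMap_le P γ (fun _ => 0) K.2 (y := x) (z := y) (by
      simpa [Real.dist_eq, dist_eq_norm] using hγ.dist_le_mul x y)
    have h2 : dist (graphMap P (fun _ => 0) x) (graphMap P (fun _ => 0) y) = dist x y := by
      rw [dist_eq_norm, dist_eq_norm, ← sq_eq_sq₀ (norm_nonneg _) (norm_nonneg _), graphMap_sub,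
        norm_toLp_sq]
      simp
    rw [h2] at h1
    simpa using h1

theorem ennreal_le_of_forall_le_pow_mul {a b : ℝ≥0∞} (m : ℕ)
    (h : ∀ δ : ℝ≥0, 0 < δ → a ≤ ((1 + δ : ℝ≥0) : ℝ≥0∞) ^ m * b) : a ≤ b := by
  have h1 : Tendsto (fun n : ℕ => ((1 + 1 / ((n : ℝ≥0) + 1) : ℝ≥0) : ℝ≥0∞) ^ m * b) atTop
      (𝓝 (1 ^ m * b)) := by
    refine ENNReal.Tendsto.mul_const ?_ (Or.inl (by simp))
    refine ENNReal.Tendsto.pow ?_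
    rw [← ENNReal.coe_one, ENNReal.tendsto_coe]
    have : Tendsto (fun n : ℕ => 1 / ((n : ℝ≥0) + 1)) atTop (𝓝 0) :=
      tendsto_one_div_add_atTop_nhds_zero_nat
    simpa using this.const_add 1
  rw [one_pow, one_mul] at h1
  exact ge_of_tendsto' h1 fun n => h _ (by positivity)

/-- The area formula for the graph of a Lipschitz function. -/
theorem euclideanHausdorffMeasure_graphMap_image [FiniteDimensional ℝ E] [Nontrivial F]
    (P : WithLp 2 (F × ℝ) ≃ₗᵢ[ℝ] E)
    {γ : F → ℝ} {K : ℝ≥0} (hγ : LipschitzWith K γ) {t : Set F} (ht : MeasurableSet t) :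
    Measure.euclideanHausdorffMeasure (Module.finrank ℝ F) (graphMap P γ '' t) =
      ∫⁻ y in t, ENNReal.ofReal (graphDensity γ y) := by
  set k := Module.finrank ℝ F
  have hemb : MeasurableEmbedding (graphMap P γ) :=
    (isClosedEmbedding_graphMap P hγ.continuous).measurableEmbedding
  set s : Set F := {y | DifferentiableAt ℝ γ y} with hs
  have hsm : MeasurableSet s := measurableSet_of_differentiableAt ℝ γ
  have hsc : volume sᶜ = 0 := hγ.ae_differentiableAt
  -- both sides are measures in `t` that vanish on the null set `sᶜ`
  set m1 : Measure F := (Measure.euclideanHausdorffMeasure k).comap (graphMap P γ) with hm1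
  set m2 : Measure F := volume.withDensity fun y => ENNReal.ofReal (graphDensity γ y) with hm2
  have e1 : ∀ u, m1 u = Measure.euclideanHausdorffMeasure k (graphMap P γ '' u) := fun u =>
    hemb.comap_apply _ u
  have e2 : ∀ u, MeasurableSet u → m2 u = ∫⁻ y in u, ENNReal.ofReal (graphDensity γ y) :=
    fun u hu => withDensity_apply _ hu
  have n1 : m1 sᶜ = 0 := by
    rw [e1]; exact euclideanHausdorffMeasure_graphMap_null P hγ hsc
  have n2 : m2 sᶜ = 0 := withDensity_absolutelyContinuous _ _ hsc
  have key : ∀ δ : ℝ≥0, 0 < δ → m1 t ≤ ((1 + δ : ℝ≥0) : ℝ≥0∞) ^ (k + 1) * m2 t ∧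
      m2 t ≤ ((1 + δ : ℝ≥0) : ℝ≥0∞) ^ (k + 1) * m1 t := by
    intro δ hδ
    obtain ⟨p, A, hdisj, hpm, hcov, happ, -⟩ :=
      exists_partition_approximatesLinearOn_of_hasFDerivWithinAt γ s (fderiv ℝ γ)
        (fun y hy => (show DifferentiableAt ℝ γ y from hy).hasFDerivAt.hasFDerivWithinAt)
        (fun _ => δ) (fun _ => hδ.ne')
    have hum : ∀ n, MeasurableSet (t ∩ (s ∩ p n)) := fun n => ht.inter (hsm.inter (hpm n))
    have hsum : ∀ m : Measure F, m sᶜ = 0 → m t = ∑' n, m (t ∩ (s ∩ p n)) := by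
      intro m hm
      have a1 : m t = m (t ∩ s) := by
        refine le_antisymm ?_ (measure_mono inter_subset_left)
        refine (measure_le_inter_add_sdiff m t s).trans ?_
        have : m (t \ s) = 0 := measure_mono_null (fun x hx => hx.2) hm
        rw [this, add_zero]
      have a2 : t ∩ s = ⋃ n, t ∩ (s ∩ p n) := by
        rw [← inter_iUnion, ← inter_iUnion, inter_eq_left.2 hcov]
      rw [a1, a2, measure_iUnion _ hum]
      intro i j hij
      exact (hdisj hij).mono (fun x hx => hx.2.2) (fun x hx => hx.2.2)
    have hest : ∀ n, m1 (t ∩ (s ∩ p n)) ≤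
          ((1 + δ : ℝ≥0) : ℝ≥0∞) ^ (k + 1) * m2 (t ∩ (s ∩ p n)) ∧
        m2 (t ∩ (s ∩ p n)) ≤ ((1 + δ : ℝ≥0) : ℝ≥0∞) ^ (k + 1) * m1 (t ∩ (s ∩ p n)) := by
      intro n
      rw [e1, e2 _ (hum n)]
      exact area_estimate_of_approximatesLinearOn P ((happ n).mono_set inter_subset_right) (hum n)
        fun y hy => hy.2.1
    rw [hsum m1 n1, hsum m2 n2, ← ENNReal.tsum_mul_left, ← ENNReal.tsum_mul_left]
    exact ⟨ENNReal.tsum_le_tsum fun n => (hest n).1, ENNReal.tsum_le_tsum fun n => (hest n).2⟩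
  rw [← e1, ← e2 t ht]
  exact le_antisymm (ennreal_le_of_forall_le_pow_mul _ fun δ hδ => (key δ hδ).1)
    (ennreal_le_of_forall_le_pow_mul _ fun δ hδ => (key δ hδ).2)

/-- The surface measure of a Lipschitz graph is the image of the measure `√(1 + |∇γ|²) dy`. -/
theorem restrict_range_graphMap [FiniteDimensional ℝ E] [Nontrivial F]
    (P : WithLp 2 (F × ℝ) ≃ₗᵢ[ℝ] E)
    {γ : F → ℝ} {K : ℝ≥0} (hγ : LipschitzWith K γ) :
    (Measure.euclideanHausdorffMeasure (Module.finrank ℝ F) : Measure E).restrict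
      (range (graphMap P γ)) =
    (volume.withDensity fun y => ENNReal.ofReal (graphDensity γ y)).map (graphMap P γ) := by
  have hc := continuous_graphMap P hγ.continuous
  refine Measure.ext fun u hu => ?_
  have hpre : MeasurableSet (graphMap P γ ⁻¹' u) := hc.measurable hu
  rw [Measure.restrict_apply hu, Measure.map_apply hc.measurable hu, withDensity_apply _ hpre,
    ← euclideanHausdorffMeasure_graphMap_image P hγ hpre, image_preimage_eq_inter_range]

end Graph

/-! ### Boundary and exterior normal of local epigraphs -/

section Epigraph

open scoped NNReal

variable {d : ℕ} {F : Type*} [NormedAddCommGroup F] [InnerProductSpace ℝ F]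

/-- In the set `V`, the set `A` is the strict epigraph of `γ` in the orthogonal coordinates given
by `P`. -/
def IsEpigraphOn (P : WithLp 2 (F × ℝ) ≃ₗᵢ[ℝ] Euc d) (γ : F → ℝ) (A V : Set (Euc d)) : Prop :=
  ∀ y t, P (WithLp.toLp 2 (y, t)) ∈ V → (P (WithLp.toLp 2 (y, t)) ∈ A ↔ γ y < t)

theorem exists_eq_toLp (P : WithLp 2 (F × ℝ) ≃ₗᵢ[ℝ] Euc d) (x : Euc d) :
    ∃ y t, P (WithLp.toLp 2 (y, t)) = x :=
  ⟨(P.symm x).fst, (P.symm x).snd, P.apply_symm_apply x⟩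

theorem mem_range_graphMap {P : WithLp 2 (F × ℝ) ≃ₗᵢ[ℝ] Euc d} {γ : F → ℝ} {y : F} {t : ℝ} :
    P (WithLp.toLp 2 (y, t)) ∈ range (graphMap P γ) ↔ γ y = t := by
  constructor
  · rintro ⟨z, hz⟩
    have := (WithLp.toLp_injective 2) (P.injective hz)
    rw [Prod.mk.injEq] at this
    rw [← this.1, this.2]
  · rintro rfl
    exact ⟨y, rfl⟩

theorem continuous_toLp (P : WithLp 2 (F × ℝ) ≃ₗᵢ[ℝ] Euc d) :
    Continuous fun z : F × ℝ => P (WithLp.toLp 2 z) :=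
  P.continuous.comp (WithLp.prod_continuous_toLp 2 F ℝ)

theorem IsEpigraphOn.frontier_inter {P : WithLp 2 (F × ℝ) ≃ₗᵢ[ℝ] Euc d} {γ : F → ℝ}
    {A V : Set (Euc d)} (h : IsEpigraphOn P γ A V) (hV : IsOpen V) (hγ : Continuous γ) :
    frontier A ∩ V = range (graphMap P γ) ∩ V := by
  ext x
  obtain ⟨y, t, rfl⟩ := exists_eq_toLp P x
  refine and_congr_left fun hxV => ?_
  rw [mem_range_graphMap]
  have hc1 : Continuous fun x => (P.symm x).fst := by fun_prop
  have hc2 : Continuous fun x => (P.symm x).snd := by fun_prop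
  have hmem : ∀ x ∈ V, x ∈ A ↔ γ (P.symm x).fst < (P.symm x).snd := by
    intro x hx
    obtain ⟨z, s, rfl⟩ := exists_eq_toLp P x
    simpa using h z s hx
  constructor
  · intro hx
    rcases lt_trichotomy (γ y) t with hlt | heq | hgt
    · exfalso
      refine hx.2 (mem_interior_iff_mem_nhds.2 ?_)
      filter_upwards [hV.mem_nhds hxV, (isOpen_lt (hγ.comp hc1) hc2).mem_nhds
        (by simpa using hlt : P (WithLp.toLp 2 (y, t)) ∈ {x | (γ ∘ fun x => (P.symm x).fst) x <
          (P.symm x).snd})] with x h1 h2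
      exact (hmem x h1).2 h2
    · exact heq
    · exfalso
      have := mem_closure_iff_nhds.1 hx.1 _ (inter_mem (hV.mem_nhds hxV)
        ((isOpen_lt hc2 (hγ.comp hc1)).mem_nhds
        (by simpa using hgt : P (WithLp.toLp 2 (y, t)) ∈ {x | (P.symm x).snd <
          (γ ∘ fun x => (P.symm x).fst) x})))
      obtain ⟨x, ⟨h1, h2⟩, h3⟩ := this
      exact lt_asymm h2 ((hmem x h1).1 h3)
  · rintro rfl
    have hnot : P (WithLp.toLp 2 (y, γ y)) ∉ A := fun hA => lt_irrefl _ ((h _ _ hxV).1 hA)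
    refine ⟨?_, fun hi => hnot (interior_subset hi)⟩
    have hcont : Tendsto (fun s : ℝ => P (WithLp.toLp 2 (y, s))) (𝓝[>] γ y)
        (𝓝 (P (WithLp.toLp 2 (y, γ y)))) :=
      (((continuous_toLp P).comp (continuous_const.prodMk continuous_id)).tendsto
        (γ y)).mono_left nhdsWithin_le_nhds
    refine mem_closure_of_tendsto hcont ?_
    filter_upwards [hcont.eventually (hV.mem_nhds hxV), self_mem_nhdsWithin] with s h1 h2
    exact (h _ _ h1).2 h2

variable [CompleteSpace F]

/-- The downward unit normal `(∇γ, -1) / √(1 + |∇γ|²)` of the graph of `γ`. -/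
def graphNormal (P : WithLp 2 (F × ℝ) ≃ₗᵢ[ℝ] Euc d) (γ : F → ℝ) (y : F) : Euc d :=
  (graphDensity γ y)⁻¹ • P (WithLp.toLp 2 (gradient γ y, -1))

theorem inner_graphNormal (P : WithLp 2 (F × ℝ) ≃ₗᵢ[ℝ] Euc d) (γ : F → ℝ) (y z : F) (t : ℝ) :
    ⟪graphNormal P γ y, P (WithLp.toLp 2 (z, t))⟫ =
      (graphDensity γ y)⁻¹ * (fderiv ℝ γ y z - t) := by
  rw [graphNormal, inner_smul_left, P.inner_map_map, WithLp.prod_inner_apply]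
  simp [gradient, sub_eq_add_neg]

theorem norm_graphNormal (P : WithLp 2 (F × ℝ) ≃ₗᵢ[ℝ] Euc d) (γ : F → ℝ) (y : F) :
    ‖graphNormal P γ y‖ = 1 := by
  have h1 : ‖P (WithLp.toLp 2 (gradient γ y, -1))‖ = graphDensity γ y := by
    rw [graphDensity, eq_comm, Real.sqrt_eq_iff_mul_self_eq (by positivity) (norm_nonneg _),
      ← pow_two, norm_toLp_sq, gradient, LinearIsometryEquiv.norm_map]
    ring
  have h2 : 0 < graphDensity γ y := by linarith [one_le_graphDensity γ y]
  rw [graphNormal, norm_smul, h1, norm_inv, Real.norm_of_nonneg h2.le, inv_mul_cancel₀ h2.ne']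

/-- Where `γ` is differentiable, its graph has the exterior unit normal `graphNormal`. -/
theorem IsEpigraphOn.isExteriorUnitNormal {P : WithLp 2 (F × ℝ) ≃ₗᵢ[ℝ] Euc d} {γ : F → ℝ}
    {A V : Set (Euc d)} (h : IsEpigraphOn P γ A V) (hV : IsOpen V) {y : F}
    (hy : graphMap P γ y ∈ V) (hd : DifferentiableAt ℝ γ y) :
    IsExteriorUnitNormal A (graphMap P γ y) (graphNormal P γ y) := by
  refine ⟨norm_graphNormal P γ y, fun ε hε => ?_⟩
  obtain ⟨r₁, hr₁, hball⟩ := Metric.isOpen_iff.1 hV _ hy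
  obtain ⟨r₂, hr₂, hdiff⟩ := Metric.eventually_nhds_iff.1 (hd.hasFDerivAt.isLittleO.def hε)
  refine ⟨min r₁ r₂, lt_min hr₁ hr₂, fun x hx => ?_⟩
  obtain ⟨z, t, rfl⟩ := exists_eq_toLp P x
  have hsub : P (WithLp.toLp 2 (z, t)) - graphMap P γ y =
      P (WithLp.toLp 2 (z - y, t - γ y)) := by
    rw [graphMap, ← map_sub]; rfl
  set R := ‖P (WithLp.toLp 2 (z, t)) - graphMap P γ y‖ with hR
  have hzR : ‖z - y‖ ≤ R := by
    refine le_of_sq_le_sq ?_ (norm_nonneg _)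
    rw [hR, hsub, norm_toLp_sq]
    nlinarith [sq_nonneg (t - γ y)]
  have hxR : R < min r₁ r₂ := mem_ball_iff_norm.1 hx
  have hzd : |γ z - γ y - fderiv ℝ γ y (z - y)| ≤ ε * ‖z - y‖ := hdiff (by
    rw [dist_eq_norm]; exact hzR.trans_lt (hxR.trans_le (min_le_right _ _)))
  have hxV : P (WithLp.toLp 2 (z, t)) ∈ V :=
    hball (mem_ball_iff_norm.2 (hxR.trans_le (min_le_left _ _)))
  rw [h z t hxV, hsub, inner_graphNormal]
  have hJ := one_le_graphDensity γ y
  have hJ0 : 0 < graphDensity γ y := by linarith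
  have hεR : ε * ‖z - y‖ ≤ graphDensity γ y * (ε * R) := by
    have : ε * ‖z - y‖ ≤ ε * R := by gcongr
    nlinarith [norm_nonneg (P (WithLp.toLp 2 (z, t)) - graphMap P γ y), mul_nonneg hε.le
      (norm_nonneg (P (WithLp.toLp 2 (z, t)) - graphMap P γ y))]
  rw [abs_le] at hzd
  constructor
  · intro hlt
    rw [inv_mul_lt_iff₀ hJ0] at hlt
    nlinarith [hzd.2]
  · intro hlt
    rw [lt_inv_mul_iff₀ hJ0] at hlt
    rw [not_lt]
    nlinarith [hzd.1]

theorem exteriorNormal_eq {A : Set (Euc d)} {x n : Euc d} (h : IsExteriorUnitNormal A x n) :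
    exteriorNormal A x = n := by
  have hex : ∃ n, IsExteriorUnitNormal A x n := ⟨n, h⟩
  rw [exteriorNormal, dif_pos hex]
  exact hex.choose_spec.unique h

end Epigraph

section Coordinates

variable {d : ℕ}

/-- Around each boundary point, a bounded Lipschitz domain is a Lipschitz epigraph in orthogonal
coordinates `ℝᵈ⁻¹ × ℝ`. -/
theorem IsBoundedLipschitzDomain.exists_isEpigraphOn (hd : 0 < d) {S : Set (Euc d)}
    (hS : IsBoundedLipschitzDomain S) {x₀ : Euc d} (hx₀ : x₀ ∈ frontier S) :
    ∃ (P : WithLp 2 (Euc (d - 1) × ℝ) ≃ₗᵢ[ℝ] Euc d) (V : Set (Euc d)) (K : NNReal)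
      (γ : Euc (d - 1) → ℝ), IsOpen V ∧ x₀ ∈ V ∧ LipschitzWith K γ ∧ IsEpigraphOn P γ S V := by
  obtain ⟨e, he, r, hr, K, γ, hγ, hloc⟩ := hS.lipschitz_boundary x₀ hx₀
  have hfin : Module.finrank ℝ (Euc d) = (d - 1) + 1 := by
    rw [finrank_euclideanSpace_fin]; omega
  have : Fact (Module.finrank ℝ (Euc d) = (d - 1) + 1) := ⟨hfin⟩
  have he0 : e ≠ 0 := by rintro rfl; simp at he
  set Φ : Euc (d - 1) →ₗᵢ[ℝ] Euc d := (Submodule.subtypeₗᵢ _).comp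
    (OrthonormalBasis.fromOrthogonalSpanSingleton (𝕜 := ℝ) (d - 1) he0).repr.symm.toLinearIsometry
  have hΦ : ∀ y, ⟪e, Φ y⟫ = 0 := fun y =>
    Submodule.mem_orthogonal_singleton_iff_inner_right.1
      ((OrthonormalBasis.fromOrthogonalSpanSingleton (𝕜 := ℝ) (d - 1) he0).repr.symm y).2
  have hee : ⟪e, e⟫ = 1 := by rw [real_inner_self_eq_norm_sq, he]; norm_num
  set P₀ : WithLp 2 (Euc (d - 1) × ℝ) →ₗᵢ[ℝ] Euc d :=
    { toFun := fun z => Φ z.fst + z.snd • e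
      map_add' := fun z w => by
        simp only [WithLp.add_fst, WithLp.add_snd, map_add, add_smul]; abel
      map_smul' := fun c z => by
        simp only [WithLp.smul_fst, WithLp.smul_snd, map_smul, RingHom.id_apply, smul_add,
          smul_smul, smul_eq_mul]
      norm_map' := fun z => by
        rw [← sq_eq_sq₀ (norm_nonneg _) (norm_nonneg _), WithLp.prod_norm_sq_eq_of_L2]
        change ‖Φ z.fst + z.snd • e‖ ^ 2 = _
        rw [norm_add_sq_real, inner_smul_right, real_inner_comm, hΦ, norm_smul, he,
          LinearIsometry.norm_map]
        simp } with hP₀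
  have hdim : Module.finrank ℝ (WithLp 2 (Euc (d - 1) × ℝ)) = Module.finrank ℝ (Euc d) := by
    rw [hfin, LinearEquiv.finrank_eq (WithLp.linearEquiv 2 ℝ (Euc (d - 1) × ℝ))]
    simp
  refine ⟨P₀.toLinearIsometryEquiv hdim, Metric.ball x₀ r, K, γ ∘ Φ, Metric.isOpen_ball,
    Metric.mem_ball_self hr, ?_, ?_⟩
  · simpa using hγ.comp Φ.lipschitz
  · intro y t hx
    have hval : P₀.toLinearIsometryEquiv hdim (WithLp.toLp 2 (y, t)) = Φ y + t • e := rfl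
    rw [hloc _ hx, hval]
    have hin : ⟪e, Φ y + t • e⟫ = t := by
      rw [inner_add_right, hΦ, inner_smul_right, hee]; simp
    rw [hin, add_sub_cancel_right]
    rfl

theorem frontier_sensor (S : Set (Euc d)) (p : Euc d) :
    frontier (sensor S p) = sensor (frontier S) p :=
  ((Homeomorph.addRight p).image_frontier S).symm

/-- Translates of bounded Lipschitz domains are bounded Lipschitz domains. -/
theorem IsBoundedLipschitzDomain.sensor {S : Set (Euc d)} (hS : IsBoundedLipschitzDomain S)
    (p : Euc d) : IsBoundedLipschitzDomain (sensor S p) where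
  isOpen := (Homeomorph.addRight p).isOpenMap _ hS.isOpen
  isConnected := hS.isConnected.image _ (by fun_prop)
  isBounded := by
    obtain ⟨C, hC⟩ := hS.isBounded.exists_norm_le
    refine (isBounded_iff_forall_norm_le).2 ⟨C + ‖p‖, ?_⟩
    rintro _ ⟨x, hx, rfl⟩
    exact (norm_add_le _ _).trans (by linarith [hC x hx])
  lipschitz_boundary := by
    intro x₀ hx₀
    rw [frontier_sensor, mem_sensor] at hx₀
    obtain ⟨e, he, r, hr, K, γ, hγ, hloc⟩ := hS.lipschitz_boundary _ hx₀
    refine ⟨e, he, r, hr, K, fun x => γ (x - (p - ⟪e, p⟫ • e)) + ⟪e, p⟫, ?_, fun x hx => ?_⟩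
    · refine LipschitzWith.of_dist_le_mul fun x y => ?_
      have := hγ.dist_le_mul (x - (p - ⟪e, p⟫ • e)) (y - (p - ⟪e, p⟫ • e))
      simpa using this
    · have hx' : x - p ∈ Metric.ball (x₀ - p) r := by simpa using hx
      rw [mem_sensor, hloc _ hx', inner_sub_right, lt_sub_iff_add_lt]
      have : x - p - (⟪e, x⟫ - ⟪e, p⟫) • e = x - ⟪e, x⟫ • e - (p - ⟪e, p⟫ • e) := by
        rw [sub_smul]; abel
      rw [this]

end Coordinates

/-! ### Moving a Lipschitz graph: the derivative of volume integrals of continuous functions -/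

section Epigraph

open scoped NNReal

theorem hasDerivAt_integral_Ioi {f : ℝ → ℝ} (hf : Continuous f) (hi : Integrable f) (a : ℝ) :
    HasDerivAt (fun a => ∫ s in Ioi a, f s) (-f a) a := by
  have h1 := (hf.integral_hasStrictDerivAt a a).hasDerivAt.const_sub (∫ s in Ioi a, f s)
  refine h1.congr_of_eventuallyEq (Eventually.of_forall fun b => ?_)
  have := intervalIntegral.integral_interval_add_Ioi (a := a) (b := b) hi.integrableOn
    hi.integrableOn
  simp only
  linarith

theorem abs_integral_Ioi_sub_le {f : ℝ → ℝ} (hi : Integrable f) {M : ℝ} (hM : ∀ s, |f s| ≤ M)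
    (a b : ℝ) : |(∫ s in Ioi a, f s) - ∫ s in Ioi b, f s| ≤ M * |a - b| := by
  rw [intervalIntegral.integral_Ioi_sub_Ioi' hi.integrableOn hi.integrableOn, abs_sub_comm a b]
  exact intervalIntegral.norm_integral_le_of_norm_le_const (f := f) (C := M) fun s _ => hM s

variable {F : Type*} [NormedAddCommGroup F] [InnerProductSpace ℝ F]

/-- The epigraph of `γ`, translated by `t (q', τ)`. -/
def movedEpigraph (γ : F → ℝ) (q' : F) (τ t : ℝ) : Set (F × ℝ) :=
  {z | γ (z.1 - t • q') + t * τ < z.2}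

variable [MeasurableSpace F] [BorelSpace F]

theorem measurableSet_movedEpigraph {γ : F → ℝ} (hγ : Continuous γ) (q' : F) (τ t : ℝ) :
    MeasurableSet (movedEpigraph γ q' τ t) :=
  (isOpen_lt (by fun_prop) (by fun_prop)).measurableSet

variable [FiniteDimensional ℝ F]

theorem integral_movedEpigraph {γ : F → ℝ} (hγ : Continuous γ) {g : F × ℝ → ℝ}
    (hi : Integrable g) (q' : F) (τ t : ℝ) :
    Integrable (fun y => ∫ s in Ioi (γ (y - t • q') + t * τ), g (y, s)) ∧
    ∫ z in movedEpigraph γ q' τ t, g z =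
      ∫ y, ∫ s in Ioi (γ (y - t • q') + t * τ), g (y, s) := by
  have hm := measurableSet_movedEpigraph hγ q' τ t
  have hi' : Integrable ((movedEpigraph γ q' τ t).indicator g) (volume.prod volume) :=
    hi.indicator hm
  have e : ∀ y, ∫ s, (movedEpigraph γ q' τ t).indicator g (y, s) =
      ∫ s in Ioi (γ (y - t • q') + t * τ), g (y, s) := by
    intro y
    rw [← integral_indicator measurableSet_Ioi]
    rfl
  refine ⟨by simpa only [e] using hi'.integral_prod_left, ?_⟩
  rw [← integral_indicator hm]
  simp only [← e]
  exact integral_prod _ hi'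

/-- The derivative at `t = 0` of the integral of a continuous function over the translated
epigraph: differentiation under the integral sign, using that `γ` is Lipschitz, and differentiable
almost everywhere by Rademacher's theorem. -/
theorem hasDerivAt_integral_movedEpigraph {γ : F → ℝ} {K : ℝ≥0} (hγ : LipschitzWith K γ)
    {g : F × ℝ → ℝ} (hg : Continuous g) (hc : HasCompactSupport g) (q' : F) (τ : ℝ) :
    Integrable (fun y => g (y, γ y) * (fderiv ℝ γ y q' - τ)) ∧
    HasDerivAt (fun t => ∫ z in movedEpigraph γ q' τ t, g z)
      (∫ y, g (y, γ y) * (fderiv ℝ γ y q' - τ)) 0 := by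
  have hi : Integrable g := hg.integrable_of_hasCompactSupport hc
  obtain ⟨M, hM⟩ := hg.norm.bddAbove_range_of_hasCompactSupport hc.norm
  have hM : ∀ z, |g z| ≤ M := fun z => hM ⟨z, rfl⟩
  have hM0 : 0 ≤ M := (abs_nonneg _).trans (hM 0)
  have hcy : ∀ y, HasCompactSupport fun s => g (y, s) := fun y =>
    hc.comp_isClosedEmbedding (IsClosedEmbedding.of_continuous_injective_isClosedMap
      (f := fun s : ℝ => (y, s)) (by fun_prop)
      (fun a b h => (Prod.mk.inj h).2) (isClosedMap_prodMk_left y))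
  have hgy : ∀ y, Continuous fun s => g (y, s) := fun y => by fun_prop
  have hiy : ∀ y, Integrable fun s => g (y, s) := fun y =>
    (hgy y).integrable_of_hasCompactSupport (hcy y)
  set B : Set F := Prod.fst '' tsupport g with hB
  have hBc : IsCompact B := hc.isCompact.image continuous_fst
  have hgB : ∀ y ∉ B, ∀ s, g (y, s) = 0 := fun y hy s =>
    image_eq_zero_of_notMem_tsupport fun h => hy ⟨_, h, rfl⟩
  set b : F → ℝ := B.indicator fun _ => M * (K * ‖q'‖ + |τ|) with hb
  have key := hasDerivAt_integral_of_dominated_loc_of_lip (μ := (volume : Measure F))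
    (F := fun t y => ∫ s in Ioi (γ (y - t • q') + t * τ), g (y, s))
    (F' := fun y => g (y, γ y) * (fderiv ℝ γ y q' - τ)) (x₀ := (0 : ℝ)) (s := univ) (bound := b)
    univ_mem ?_ ?_ ?_ ?_ ?_ ?_
  · refine ⟨key.1, key.2.congr_of_eventuallyEq (Eventually.of_forall fun t => ?_)⟩
    exact (integral_movedEpigraph hγ.continuous hi q' τ t).2
  · exact Eventually.of_forall fun t =>
      (integral_movedEpigraph hγ.continuous hi q' τ t).1.aestronglyMeasurable
  · exact (integral_movedEpigraph hγ.continuous hi q' τ 0).1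
  · have h1 : Measurable fun y => g (y, γ y) :=
      (hg.comp (continuous_id.prodMk hγ.continuous)).measurable
    exact (h1.mul ((measurable_fderiv_apply_const ℝ γ q').sub_const τ)).aestronglyMeasurable
  · refine Eventually.of_forall fun y => LipschitzOnWith.of_dist_le_mul fun t _ t' _ => ?_
    rw [Real.dist_eq, Real.dist_eq]
    by_cases hy : y ∈ B
    · have hb0 : 0 ≤ M * (K * ‖q'‖ + |τ|) := by positivity
      rw [hb, indicator_of_mem hy, Real.coe_nnabs, abs_of_nonneg hb0]
      refine (abs_integral_Ioi_sub_le (hiy y) (fun s => hM _) _ _).trans ?_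
      rw [mul_assoc]
      gcongr
      have h1 := hγ.dist_le_mul (y - t • q') (y - t' • q')
      rw [Real.dist_eq, dist_eq_norm] at h1
      have h2 : ‖y - t • q' - (y - t' • q')‖ = |t - t'| * ‖q'‖ := by
        rw [← Real.norm_eq_abs, ← norm_smul, ← norm_neg, sub_smul]; congr 1; abel
      rw [h2] at h1
      have e : γ (y - t • q') + t * τ - (γ (y - t' • q') + t' * τ) =
          (γ (y - t • q') - γ (y - t' • q')) + (t - t') * τ := by ring
      rw [e]
      refine (abs_add_le _ _).trans ?_
      rw [abs_mul]
      linarith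
    · simp [hgB y hy, hb, hy]
  · exact (integrable_indicator_iff hBc.measurableSet).2
      (integrableOn_const hBc.measure_lt_top.ne)
  · filter_upwards [hγ.ae_differentiableAt] with y hy
    have h1 : HasDerivAt (fun t : ℝ => y - t • q') (-q') 0 := by
      simpa using ((hasDerivAt_id (0 : ℝ)).smul_const q').const_sub y
    have hy' : HasFDerivAt γ (fderiv ℝ γ y) (y - (0 : ℝ) • q') := by simpa using hy.hasFDerivAt
    have h2 : HasDerivAt (fun t : ℝ => γ (y - t • q') + t * τ) (-fderiv ℝ γ y q' + τ) 0 := by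
      simpa [Function.comp_def] using (hy'.comp_hasDerivAt (0 : ℝ) h1).fun_add
        ((hasDerivAt_id' (0 : ℝ)).mul_const τ)
    have h3 := (hasDerivAt_integral_Ioi (hgy y) (hiy y)
      (γ (y - (0 : ℝ) • q') + 0 * τ)).comp (0 : ℝ) h2
    convert! h3 using 1
    simp
    ring

end Epigraph

section Boundary

open scoped NNReal

variable {d : ℕ}

theorem eventually_translate_mem {V : Set (Euc d)} (hV : IsOpen V) {w : Euc d → ℝ}
    (hc : HasCompactSupport w) (hw : tsupport w ⊆ V) (q : Euc d) :
    ∀ᶠ t : ℝ in 𝓝 0, ∀ x, w (x + t • q) ≠ 0 → x ∈ V := by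
  obtain ⟨δ, hδ, hsub⟩ := hc.isCompact.exists_thickening_subset_open hV hw
  have ht : Tendsto (fun t : ℝ => ‖t • q‖) (𝓝 0) (𝓝 0) := by
    have : Continuous fun t : ℝ => ‖t • q‖ := by fun_prop
    simpa using this.tendsto 0
  filter_upwards [(tendsto_order.1 ht).2 δ hδ] with t htδ x hx
  refine hsub (Metric.mem_thickening_iff.2 ⟨x + t • q, subset_tsupport _ hx, ?_⟩)
  rw [dist_eq_norm, ← norm_neg]
  simpa using htδ

theorem measurePreserving_toLp (k : ℕ) (P : WithLp 2 (Euc k × ℝ) ≃ₗᵢ[ℝ] Euc d) :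
    MeasurePreserving fun z : Euc k × ℝ => P (WithLp.toLp 2 z) :=
  P.measurePreserving.comp (WithLp.volume_preserving_toLp (Euc k) ℝ)

theorem measurableEmbedding_toLp (k : ℕ) (P : WithLp 2 (Euc k × ℝ) ≃ₗᵢ[ℝ] Euc d) :
    MeasurableEmbedding fun z : Euc k × ℝ => P (WithLp.toLp 2 z) :=
  P.toMeasurableEquiv.measurableEmbedding.comp
    (MeasurableEquiv.toLp 2 (Euc k × ℝ)).measurableEmbedding

/-- The property of a test function `w` that the derivative of `∫_{A + t q} w` at `t = 0` is the
boundary integral of `(ν · q) w`. -/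
def HasBoundaryDeriv (A : Set (Euc d)) (q : Euc d) (w : Euc d → ℝ) : Prop :=
  Integrable (fun x => ⟪exteriorNormal A x, q⟫ * w x) (surfaceMeasure A) ∧
    HasDerivAt (fun t : ℝ => ∫ x in A, w (x + t • q))
      (∫ x, ⟪exteriorNormal A x, q⟫ * w x ∂(surfaceMeasure A)) 0

theorem IsEpigraphOn.eventually_setIntegral_eq {k : ℕ} {P : WithLp 2 (Euc k × ℝ) ≃ₗᵢ[ℝ] Euc d}
    {γ : Euc k → ℝ} {A V : Set (Euc d)} (h : IsEpigraphOn P γ A V) (hV : IsOpen V)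
    (hA : MeasurableSet A) (hγ : Continuous γ) {w : Euc d → ℝ} (hc : HasCompactSupport w)
    (hwV : tsupport w ⊆ V) (q' : Euc k) (τ : ℝ) :
    ∀ᶠ t : ℝ in 𝓝 0, ∫ x in A, w (x + t • P (WithLp.toLp 2 (q', τ))) =
      ∫ z in movedEpigraph γ q' τ t, w (P (WithLp.toLp 2 z)) := by
  filter_upwards [eventually_translate_mem hV hc hwV (P (WithLp.toLp 2 (q', τ)))] with t ht
  set q := P (WithLp.toLp 2 (q', τ)) with hq
  have hmp := measurePreserving_toLp k P
  have hme := measurableEmbedding_toLp k P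
  rw [← integral_indicator hA, ← integral_indicator (measurableSet_movedEpigraph hγ q' τ t),
    ← integral_sub_right_eq_self _ (t • q), ← hmp.integral_comp hme]
  refine integral_congr_ae (Eventually.of_forall fun z => ?_)
  obtain ⟨y, s⟩ := z
  have e : P (WithLp.toLp 2 (y, s)) - t • q = P (WithLp.toLp 2 (y - t • q', s - t * τ)) := by
    rw [hq, ← map_smul, ← map_sub]; rfl
  have hmem : (y, s) ∈ movedEpigraph γ q' τ t ↔ γ (y - t • q') < s - t * τ := by
    rw [lt_sub_iff_add_lt]; rfl
  by_cases hw0 : w (P (WithLp.toLp 2 (y, s))) = 0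
  · simp only [indicator, sub_add_cancel, hw0, ite_self]
  · have hxV : P (WithLp.toLp 2 (y - t • q', s - t * τ)) ∈ V := by
      rw [← e]; exact ht _ (by simpa using hw0)
    have hiff := h _ _ hxV
    simp only [indicator, sub_add_cancel]
    simp only [e, hiff, hmem]

/-- For a continuous function supported near a boundary point, the derivative of `∫_{A + t q} w` is
the boundary integral of `(ν · q) w`, by the area formula for the graph. -/
theorem IsEpigraphOn.hasBoundaryDeriv (hd : 2 ≤ d)
    {P : WithLp 2 (Euc (d - 1) × ℝ) ≃ₗᵢ[ℝ] Euc d} {γ : Euc (d - 1) → ℝ} {A V : Set (Euc d)}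
    (h : IsEpigraphOn P γ A V) (hV : IsOpen V) (hA : MeasurableSet A) {K : ℝ≥0}
    (hγ : LipschitzWith K γ) {w : Euc d → ℝ} (hw : Continuous w) (hc : HasCompactSupport w)
    (hwV : tsupport w ⊆ V) (q : Euc d) : HasBoundaryDeriv A q w := by
  obtain ⟨q', τ, rfl⟩ := exists_eq_toLp P q
  set q := P (WithLp.toLp 2 (q', τ)) with hq
  have hfin : Module.finrank ℝ (Euc (d - 1)) = d - 1 := finrank_euclideanSpace_fin
  have : Nontrivial (Euc (d - 1)) := Module.nontrivial_of_finrank_pos (R := ℝ) (by omega)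
  set g : Euc (d - 1) × ℝ → ℝ := fun z => w (P (WithLp.toLp 2 z)) with hg
  have hgc : Continuous g := hw.comp (continuous_toLp P)
  have hgs : HasCompactSupport g := by
    refine hc.comp_isClosedEmbedding (g := fun z : Euc (d - 1) × ℝ => P (WithLp.toLp 2 z)) ?_
    exact (P.toHomeomorph.isClosedEmbedding).comp
      (WithLp.homeomorphProd 2 (Euc (d - 1)) ℝ).symm.isClosedEmbedding
  obtain ⟨hint, hder⟩ := hasDerivAt_integral_movedEpigraph hγ hgc hgs q' τ
  have hwz : ∀ x ∉ V, w x = 0 := fun x hx =>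
    image_eq_zero_of_notMem_tsupport fun hx' => hx (hwV hx')
  have hemb : MeasurableEmbedding (graphMap P γ) :=
    (isClosedEmbedding_graphMap P hγ.continuous).measurableEmbedding
  set f : Euc d → ℝ := fun x => ⟪exteriorNormal A x, q⟫ * w x with hf
  -- the boundary integrand in the coordinates of the graph
  have hpt : ∀ᵐ y ∂(volume : Measure (Euc (d - 1))),
      (ENNReal.ofReal (graphDensity γ y)).toReal • f (graphMap P γ y) =
        g (y, γ y) * (fderiv ℝ γ y q' - τ) := by
    filter_upwards [hγ.ae_differentiableAt] with y hy
    have hJ : 0 < graphDensity γ y := by linarith [one_le_graphDensity γ y]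
    have hgw : g (y, γ y) = w (graphMap P γ y) := rfl
    by_cases hyV : graphMap P γ y ∈ V
    · rw [ENNReal.toReal_ofReal hJ.le, hf, smul_eq_mul]
      simp only
      rw [exteriorNormal_eq (h.isExteriorUnitNormal hV hyV hy), hq, inner_graphNormal, hgw]
      field_simp
    · rw [hgw, hf]
      simp [hwz _ hyV]
  have hdens : Measurable fun y => ENNReal.ofReal (graphDensity γ y) :=
    (measurable_graphDensity γ).ennreal_ofReal
  have hrange := restrict_range_graphMap P hγ
  rw [hfin] at hrange
  have hfr : frontier A ∩ V = range (graphMap P γ) ∩ V := h.frontier_inter hV hγ.continuous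
  have hind : (frontier A).indicator f = (range (graphMap P γ)).indicator f := by
    ext x
    by_cases hx : x ∈ V
    · by_cases h' : x ∈ frontier A
      · rw [indicator_of_mem h', indicator_of_mem (hfr.subset ⟨h', hx⟩).1]
      · rw [indicator_of_notMem h', indicator_of_notMem fun h'' => h' (hfr.superset ⟨h'', hx⟩).1]
    · have : f x = 0 := by simp [hf, hwz x hx]
      simp only [indicator, this, ite_self]
  have hmr : MeasurableSet (range (graphMap P γ)) := hemb.measurableSet_range
  have hmf : MeasurableSet (frontier A) := isClosed_frontier.measurableSet
  have hI : Integrable f (surfaceMeasure A) := by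
    change IntegrableOn f (frontier A) _
    rw [← integrable_indicator_iff hmf, hind, integrable_indicator_iff hmr, IntegrableOn, hrange,
      hemb.integrable_map_iff, integrable_withDensity_iff_integrable_smul' hdens
        (Eventually.of_forall fun y => ENNReal.ofReal_lt_top)]
    exact hint.congr (hpt.mono fun y hy => hy.symm)
  have hval : ∫ x, f x ∂(surfaceMeasure A) = ∫ y, g (y, γ y) * (fderiv ℝ γ y q' - τ) := by
    rw [surfaceMeasure, ← integral_indicator hmf, hind, integral_indicator hmr, hrange,
      hemb.integral_map, integral_withDensity_eq_integral_toReal_smul hdens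
        (Eventually.of_forall fun y => ENNReal.ofReal_lt_top)]
    exact integral_congr_ae hpt
  refine ⟨hI, ?_⟩
  change HasDerivAt _ (∫ x, f x ∂(surfaceMeasure A)) 0
  rw [hval]
  exact hder.congr_of_eventuallyEq
    (h.eventually_setIntegral_eq hV hA hγ.continuous hc hwV q' τ)

end Boundary

/-! ### From local to global, and the boundary formula -/

section Global

variable {d : ℕ}

/-- Away from the boundary, moving the domain does not change the integral. -/
theorem hasBoundaryDeriv_of_disjoint_frontier {A V : Set (Euc d)} (hA : MeasurableSet A)
    (hV : IsOpen V) (hVf : Disjoint V (frontier A)) (hVA : V ⊆ A ∨ Disjoint V A)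
    {w : Euc d → ℝ} (hc : HasCompactSupport w) (hwV : tsupport w ⊆ V) (q : Euc d) :
    HasBoundaryDeriv A q w := by
  have hwz : ∀ x ∉ V, w x = 0 := fun x hx =>
    image_eq_zero_of_notMem_tsupport fun hx' => hx (hwV hx')
  have hae : (fun x => ⟪exteriorNormal A x, q⟫ * w x) =ᵐ[surfaceMeasure A] fun _ => (0 : ℝ) := by
    filter_upwards [ae_restrict_mem isClosed_frontier.measurableSet] with x hx
    rw [hwz x (disjoint_right.1 hVf hx), mul_zero]
  refine ⟨(integrable_zero _ _ _).congr hae.symm, ?_⟩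
  rw [integral_congr_ae hae, integral_zero]
  have hconst : ∃ c, ∀ᶠ t : ℝ in 𝓝 0, ∫ x in A, w (x + t • q) = c := by
    rcases hVA with h | h
    · refine ⟨∫ x, w x, ?_⟩
      filter_upwards [eventually_translate_mem hV hc hwV q] with t ht
      rw [← integral_add_right_eq_self w (t • q), ← integral_indicator hA]
      refine integral_congr_ae (Eventually.of_forall fun x => ?_)
      by_cases hx : w (x + t • q) = 0
      · simp only [indicator, hx, ite_self]
      · exact indicator_of_mem (h (ht x hx)) _
    · refine ⟨0, ?_⟩
      filter_upwards [eventually_translate_mem hV hc hwV q] with t ht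
      refine setIntegral_eq_zero_of_forall_eq_zero fun x hx => ?_
      by_contra hne
      exact disjoint_left.1 h (ht x hne) hx
  obtain ⟨c, hc'⟩ := hconst
  exact (hasDerivAt_const (0 : ℝ) c).congr_of_eventuallyEq hc'

theorem IsBoundedLipschitzDomain.exists_hasBoundaryDeriv (hd : 2 ≤ d) {A : Set (Euc d)}
    (hA : IsBoundedLipschitzDomain A) (x₀ : Euc d) :
    ∃ V, IsOpen V ∧ x₀ ∈ V ∧ ∀ w : Euc d → ℝ, Continuous w → HasCompactSupport w →
      tsupport w ⊆ V → ∀ q, HasBoundaryDeriv A q w := by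
  have hm := hA.isOpen.measurableSet
  by_cases hx : x₀ ∈ frontier A
  · obtain ⟨P, V, K, γ, hV, hxV, hγ, hepi⟩ := hA.exists_isEpigraphOn (by omega) hx
    exact ⟨V, hV, hxV, fun w hw hc hwV q => hepi.hasBoundaryDeriv hd hV hm hγ hw hc hwV q⟩
  by_cases hxA : x₀ ∈ A
  · exact ⟨A, hA.isOpen, hxA, fun w _ hc hwV q => hasBoundaryDeriv_of_disjoint_frontier hm
      hA.isOpen (disjoint_iff_inter_eq_empty.2 hA.isOpen.inter_frontier_eq) (Or.inl subset_rfl)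
      hc hwV q⟩
  · have hxc : x₀ ∈ (closure A)ᶜ := fun h => hx ⟨h, fun hi => hxA (interior_subset hi)⟩
    exact ⟨(closure A)ᶜ, isClosed_closure.isOpen_compl, hxc, fun w _ hc hwV q =>
      hasBoundaryDeriv_of_disjoint_frontier hm isClosed_closure.isOpen_compl
        (disjoint_compl_left.mono_right frontier_subset_closure)
        (Or.inr (disjoint_compl_left.mono_right subset_closure)) hc hwV q⟩

theorem HasBoundaryDeriv.sum {ι : Type*} (s : Finset ι) {A : Set (Euc d)} {q : Euc d}
    {w : ι → Euc d → ℝ} (hw : ∀ i ∈ s, Continuous (w i)) (hc : ∀ i ∈ s, HasCompactSupport (w i))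
    (h : ∀ i ∈ s, HasBoundaryDeriv A q (w i)) :
    HasBoundaryDeriv A q fun x => ∑ i ∈ s, w i x := by
  have e : (fun x => ⟪exteriorNormal A x, q⟫ * ∑ i ∈ s, w i x) =
      fun x => ∑ i ∈ s, ⟪exteriorNormal A x, q⟫ * w i x := by
    ext x; rw [Finset.mul_sum]
  have e' : (fun t : ℝ => ∫ x in A, ∑ i ∈ s, w i (x + t • q)) =
      fun t : ℝ => ∑ i ∈ s, ∫ x in A, w i (x + t • q) := by
    ext t
    refine integral_finsetSum _ fun i hi => ?_
    exact (((hw i hi).integrable_of_hasCompactSupport (hc i hi)).comp_add_right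
      (t • q)).integrableOn
  refine ⟨?_, ?_⟩
  · rw [e]
    exact integrable_finsetSum _ fun i hi => (h i hi).1
  · rw [e, e', integral_finsetSum _ fun i hi => (h i hi).1]
    exact HasDerivAt.fun_sum fun i hi => (h i hi).2

/-- For a bounded Lipschitz domain `A` and a continuous function `w` with compact support, the
derivative of `∫_{A + t q} w` at `t = 0` is the boundary integral of `(ν · q) w`. -/
theorem IsBoundedLipschitzDomain.hasBoundaryDeriv (hd : 2 ≤ d) {A : Set (Euc d)}
    (hA : IsBoundedLipschitzDomain A) {w : Euc d → ℝ} (hw : Continuous w)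
    (hc : HasCompactSupport w) (q : Euc d) : HasBoundaryDeriv A q w := by
  choose V hV hxV hloc using hA.exists_hasBoundaryDeriv hd
  obtain ⟨T, hT⟩ := hc.isCompact.elim_finite_subcover V hV
    fun x _ => mem_iUnion.2 ⟨x, hxV x⟩
  obtain ⟨ρ, hρ⟩ := PartitionOfUnity.exists_isSubordinate (isClosed_tsupport w)
    (fun i : T => V i) (fun i => hV i) (by rwa [iUnion_subtype])
  have hsum : w = fun x => ∑ i : T, ρ i x * w x := by
    ext x
    by_cases hx : x ∈ tsupport w
    · rw [← Finset.sum_mul, ← finsum_eq_sum_of_fintype, ρ.sum_eq_one hx, one_mul]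
    · simp [image_eq_zero_of_notMem_tsupport hx]
  have hci : ∀ i : T, Continuous fun x => ρ i x * w x := fun i => (ρ i).continuous.mul hw
  have hcs : ∀ i : T, HasCompactSupport fun x => ρ i x * w x := fun i => hc.mul_left
  rw [hsum]
  exact HasBoundaryDeriv.sum _ (fun i _ => hci i) (fun i _ => hcs i) fun i _ =>
    hloc i _ (hci i) (hcs i) ((tsupport_mul_subset_left).trans (hρ i)) q

/-- The exterior unit normal of a bounded Lipschitz domain exists almost everywhere on the
boundary: by Rademacher's theorem, and because graph maps preserve null sets. -/
theorem IsBoundedLipschitzDomain.ae_isExteriorUnitNormal (hd : 0 < d) {A : Set (Euc d)}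
    (hA : IsBoundedLipschitzDomain A) :
    ∀ᵐ x ∂(surfaceMeasure A), IsExteriorUnitNormal A x (exteriorNormal A x) := by
  rw [surfaceMeasure, ae_restrict_iff' isClosed_frontier.measurableSet, ae_iff]
  refine measure_null_of_locally_null _ fun x₀ hx₀ => ?_
  have hxf : x₀ ∈ frontier A := by
    by_contra h
    exact hx₀ fun h' => absurd h' h
  obtain ⟨P, V, K, γ, hV, hxV, hγ, hepi⟩ := hA.exists_isEpigraphOn hd hxf
  have hnull := euclideanHausdorffMeasure_graphMap_null P hγ hγ.ae_differentiableAt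
  rw [finrank_euclideanSpace_fin] at hnull
  refine ⟨_, inter_mem self_mem_nhdsWithin (mem_nhdsWithin_of_mem_nhds (hV.mem_nhds hxV)),
    measure_mono_null (fun x hx => ?_) hnull⟩
  obtain ⟨hx, hxV⟩ := hx
  have hx : x ∈ frontier A ∧ ¬ IsExteriorUnitNormal A x (exteriorNormal A x) := by
    simpa using hx
  obtain ⟨y, rfl⟩ := ((hepi.frontier_inter hV hγ.continuous).subset ⟨hx.1, hxV⟩).1
  refine ⟨y, fun hy => hx.2 ?_, rfl⟩
  have hn := hepi.isExteriorUnitNormal hV hxV hy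
  rwa [exteriorNormal_eq hn]

theorem setIntegral_sensor_add (S : Set (Euc d)) (p a : Euc d) (w : Euc d → ℝ) :
    ∫ x in sensor S (p + a), w x = ∫ x in sensor S p, w (x + a) := by
  have hpre : (fun x => x + a) ⁻¹' sensor S (p + a) = sensor S p := by
    ext x
    rw [mem_preimage, mem_sensor, mem_sensor, add_sub_add_right_eq_sub]
  rw [← hpre]
  exact ((measurePreserving_add_right volume a).setIntegral_preimage_emb
    (measurableEmbedding_addRight a) w _).symm

/-- The divergence theorem on the sensor for `v ∈ H²(D)` with continuous representative `w`, read
off from the two expressions for the derivative of `p ↦ ∫_{S(p)} v`. -/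
theorem sensorMeanDeriv_eq_boundary_integral (hd : 2 ≤ d) {D S : Set (Euc d)}
    (hD : IsBoundedLipschitzDomain D) (hS : IsBoundedLipschitzDomain S) (v : H2 D)
    {w : Euc d → ℝ} (hw : ContinuousOn w D) (hvw : H2.val D v =ᵐ[volume.restrict D] w)
    {p : Euc d} (hp : p ∈ admissible S D) (q : Euc d) :
    Integrable (fun x => ⟪exteriorNormal (sensor S p) x, q⟫ * w x)
        (surfaceMeasure (sensor S p)) ∧
      sensorMeanDeriv D hS p q v = (volume.real S)⁻¹ *
        ∫ x, ⟪exteriorNormal (sensor S p) x, q⟫ * w x ∂(surfaceMeasure (sensor S p)) := by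
  -- cut `w` off outside a neighbourhood of the sensor
  obtain ⟨δ, hδ, hδD⟩ := hp.1.exists_cthickening_subset_open hD.isOpen hp.2
  obtain ⟨χ, hχ, hχc, hχD, -, hχ1⟩ := exists_contDiff_cutoff hD.isOpen hD.isBounded
    Metric.isClosed_cthickening hδD
  set W : Euc d → ℝ := fun x => χ x * w x with hW
  have hWc : Continuous W := by
    refine continuous_of_tsupport fun x hx => ?_
    exact (hχ.continuous.continuousOn.mul hw).continuousAt
      (hD.isOpen.mem_nhds (hχD (tsupport_mul_subset_left hx)))
  have hWs : HasCompactSupport W := hχc.mul_right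
  have hWw : ∀ x ∈ Metric.cthickening δ (closure (sensor S p)), W x = w x := fun x hx => by
    simp [hW, hχ1 x hx]
  obtain ⟨hI, hder⟩ := (hS.sensor p).hasBoundaryDeriv hd hWc hWs q
  have hcongr : (fun x => ⟪exteriorNormal (sensor S p) x, q⟫ * W x)
      =ᵐ[surfaceMeasure (sensor S p)] fun x => ⟪exteriorNormal (sensor S p) x, q⟫ * w x := by
    filter_upwards [ae_restrict_mem isClosed_frontier.measurableSet] with x hx
    rw [hWw x (Metric.self_subset_cthickening _ (frontier_subset_closure hx))]
  refine ⟨hI.congr hcongr, ?_⟩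
  rw [← integral_congr_ae hcongr]
  have hline : HasDerivAt (fun t : ℝ => p + t • q) q 0 := by
    simpa using ((hasDerivAt_id (0 : ℝ)).smul_const q).const_add p
  have h1 : HasDerivAt (fun t : ℝ => sensorMean D hS (p + t • q) v)
      (sensorMeanDeriv D hS p q v) 0 := by
    have hB : HasFDerivAt (sensorMean D hS) (sensorMeanDeriv D hS p) (p + (0 : ℝ) • q) := by
      simpa using hasFDerivAt_sensorMean hD hS hp
    have h := HasFDerivAt.comp_hasDerivAt (𝕜 := ℝ) (F := Euc d) (E := H2 D →L[ℝ] ℝ) (0 : ℝ) hB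
      hline
    exact ((ContinuousLinearMap.apply ℝ ℝ v).hasFDerivAt).comp_hasDerivAt (0 : ℝ) h
  refine h1.unique ((hder.const_mul (volume.real S)⁻¹).congr_of_eventuallyEq ?_)
  have hU := (isOpen_admissible hD.isOpen hS.isBounded (S := S)).mem_nhds hp
  have ht0 : Tendsto (fun t : ℝ => ‖t • q‖) (𝓝 0) (𝓝 0) := by
    have : Continuous fun t : ℝ => ‖t • q‖ := by fun_prop
    simpa using this.tendsto 0
  have hcont : Tendsto (fun t : ℝ => p + t • q) (𝓝 0) (𝓝 p) := by
    simpa using hline.continuousAt.tendsto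
  filter_upwards [hcont.eventually hU, (tendsto_order.1 ht0).2 δ hδ] with t htU htδ
  rw [sensorMean_apply, restrict_restrict_sensor hS htU]
  congr 1
  have hae : H2.val D v =ᵐ[volume.restrict (sensor S (p + t • q))] w :=
    ae_restrict_of_ae_restrict_of_subset (sensor_subset_of_mem_admissible htU) hvw
  rw [integral_congr_ae hae, setIntegral_sensor_add]
  refine setIntegral_congr_fun (hS.sensor_meas p).1 fun x hx => (hWw _ ?_).symm
  refine Metric.mem_cthickening_of_dist_le _ x _ _ (subset_closure hx) ?_
  rw [dist_eq_norm, add_sub_cancel_left]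
  exact htδ.le

theorem sensorMeanDeriv_eq_integral_inner_grad {D S : Set (Euc d)}
    (hD : Bornology.IsBounded D) (hS : IsBoundedLipschitzDomain S) {p : Euc d}
    (hp : p ∈ admissible S D) (q : Euc d) (v : H2 D) :
    sensorMeanDeriv D hS p q v =
      (volume.real S)⁻¹ * ∫ x in sensor S p, ⟪q, H2.grad v x⟫ := by
  have : IsFiniteMeasure (volume.restrict D) := ⟨by simpa using hD.measure_lt_top⟩
  have hint : ∀ i, Integrable (H2.pd D i v) (volume.restrict (sensor S p)) := fun i => by
    have h : Integrable (H2.pd D i v) (volume.restrict D) :=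
      (Lp.memLp (H2.pd D i v)).integrable (by norm_num)
    exact h.mono_measure (Measure.restrict_mono (sensor_subset_of_mem_admissible hp) le_rfl)
  rw [sensorMeanDeriv_apply]
  congr 1
  have e : ∀ x, ⟪q, H2.grad v x⟫ = ∑ i, q i * H2.pd D i v x := fun x => by
    simp [PiLp.inner_apply, H2.grad, mul_comm]
  simp_rw [e]
  rw [integral_finsetSum _ fun i _ => (hint i).const_mul _]
  refine Finset.sum_congr rfl fun i _ => ?_
  rw [integral_const_mul, restrict_restrict_sensor hS hp]

end Global

end SensorDerivative

end

theorem mainTheorem2 (d : ℕ) (hd : d = 2 ∨ d = 3)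
    (D S : Set (Euc d))
    (hD : IsBoundedLipschitzDomain D)
    (hS : IsBoundedLipschitzDomain S) :
    -- the set `U` of admissible positions is open, and `B` has the stated values on it
    IsOpen (admissible S D) ∧
    (∀ p ∈ admissible S D, ∀ v : H2 D,
      sensorMean D hS p v =
        (volume.real S)⁻¹ * ∫ x in sensor S p, H2.val D v x) ∧
    -- Fréchet differentiability of `B : U → H²(D)*`
    (∀ p ∈ admissible S D,
      HasFDerivAt (sensorMean D hS) (sensorMeanDeriv D hS p) p) ∧
    -- the remainder estimate in the norm of `H²(D)*`
    (∃ C : ℝ, ∀ p ∈ admissible S D, ∀ q : Euc d,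
      (∀ s ∈ Icc (0 : ℝ) 1, p + s • q ∈ admissible S D) →
      ‖sensorMean D hS (p + q) - sensorMean D hS p
          - sensorMeanDeriv D hS p q‖ ≤ C * ‖q‖ ^ (3 / 2 : ℝ)) ∧
    -- the exterior unit normal of `∂S(p)` exists almost everywhere
    (∀ p ∈ admissible S D,
      ∀ᵐ x ∂(surfaceMeasure (sensor S p)),
        IsExteriorUnitNormal (sensor S p) x
          (exteriorNormal (sensor S p) x)) ∧
    -- the two formulas for the derivative; `w` is the continuous representative of `v`
    (∀ v : H2 D, ∃ w : Euc d → ℝ,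
      ContinuousOn w D ∧ H2.val D v =ᵐ[volume.restrict D] w ∧
      ∀ p ∈ admissible S D, ∀ q : Euc d,
        (sensorMeanDeriv D hS p q v =
          (volume.real S)⁻¹ * (∫ x in sensor S p, ⟪q, H2.grad v x⟫)) ∧
        Integrable (fun x => ⟪exteriorNormal (sensor S p) x, q⟫ * w x)
          (surfaceMeasure (sensor S p)) ∧
        ((volume.real S)⁻¹ * (∫ x in sensor S p, ⟪q, H2.grad v x⟫) =
          (volume.real S)⁻¹ *
            (∫ x, ⟪exteriorNormal (sensor S p) x, q⟫ * w x ∂(surfaceMeasure (sensor S p))))) := by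
  have hd2 : 2 ≤ d := by omega
  refine ⟨isOpen_admissible hD.isOpen hS.isBounded, fun p hp v => ?_,
    fun p hp => hasFDerivAt_sensorMean hD hS hp, exists_norm_sensorMean_taylor_le_rpow hD hS,
    fun p _ => (hS.sensor p).ae_isExteriorUnitNormal (by omega), fun v => ?_⟩
  · rw [sensorMean_apply, restrict_restrict_sensor hS hp]
  · obtain ⟨w, hw, hvw⟩ := exists_continuousOn_representative hd hD.isOpen hD.isBounded v
    refine ⟨w, hw, hvw, fun p hp q => ?_⟩
    have hgrad := sensorMeanDeriv_eq_integral_inner_grad hD.isBounded hS hp q v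
    obtain ⟨hint, hbd⟩ := sensorMeanDeriv_eq_boundary_integral hd2 hD hS v hw hvw hp q
    exact ⟨hgrad, hint, hgrad ▸ hbd⟩
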